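/- Consider the star graph $\mathcal G$ with two half-lines $(-\infty,0)$ and $(0,+\infty)$ joined at the vertex $0$, and the complex Hilbert space $L^2(\mathcal G)=L^2(-\infty,0)\oplus L^2(0,+\infty)$; write $u=(u_-,u_+)$ for its elements. Let $\alpha_-,\alpha_+>0$ and $\beta_-,\beta_+\in\mathbb R$, and let $A_0$ be the Airy operator $$A_0u=\big(\alpha_-u_-'''+\beta_-u_-',\ \alpha_+u_+'''+\beta_+u_+'\big),\qquad D(A_0)=C_c^\infty(-\infty,0)\oplus C_c^\infty(0,+\infty).$$ For $Z\in\mathbb R\setminus\{0\}$ let $$L_Z=\begin{pmatrix}1&0&0\\ Z&1&0\\ \tfrac{Z^2}{2}&Z&1\end{pmatrix},$$ and let $A_Z$ be the operator in $L^2(\mathcal G)$ that acts as $A_Zu=(\alpha_-u_-'''+\beta_-u_-',\ \alpha_+u_+'''+\beta_+u_+')$ (weak derivatives) on the domain $D(A_Z)$ of all $u\in H^3(-\infty,0)\oplus H^3(0,+\infty)$ that satisfy the boundary relation $$L_Z\begin{pmatrix}u_-(0-)\\u_-'(0-)\\u_-''(0-)\end{pmatrix}=\begin{pmatrix}u_+(0+)\\u_+'(0+)\\u_+''(0+)\end{pmatrix}.$$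 Then: 1. $D(A_Z)$ consists of exactly those $u\in H^3(-\infty,0)\oplus H^3(0,+\infty)$ with $$u_-(0-)=u_+(0+),\qquad u_+'(0+)-u_-'(0-)=Zu_-(0-),\qquad \tfrac{Z^2}{2}u_-(0-)+Zu_-'(0-)=u_+''(0+)-u_-''(0-).$$ 2. $A_Z$ is an extension of $A_0$. 3. $A_Z$ is skew-self-adjoint (that is, densely defined with $A_Z^*=-A_Z$) if and only if $\alpha_-=\alpha_+$ and $\beta_-=\beta_+$. 4. For each $u\in D(A_Z)$, the function on $\mathbb R$ that equals $u_-$ on $(-\infty,0)$ and $u_+$ on $(0,+\infty)$ belongs to $H^1(\mathbb R)$. -/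

import Mathlib

open MeasureTheory Filter Topology TopologicalSpace
open scoped ContDiff LinearPMap Distributions

noncomputable section

namespace AiryGraph

/-- The complex Hilbert space `L²(Ω)` of an open set `Ω ⊆ ℝ`. -/
abbrev L2 (Ω : Opens ℝ) : Type := Lp ℂ 2 (volume.restrict (Ω : Set ℝ))

/-- The negative half-line `(-∞, 0)`. -/
def negHalf : Opens ℝ := ⟨Set.Iio 0, isOpen_Iio⟩

/-- The positive half-line `(0, +∞)`. -/
def posHalf : Opens ℝ := ⟨Set.Ioi 0, isOpen_Ioi⟩

/-- `L²` of the star graph with two half-lines: the Hilbert sum `L²(-∞,0) ⊕ L²(0,+∞)`.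
The components of `u` are `u.fst = u₋` and `u.snd = u₊`. -/
abbrev L2Graph : Type := WithLp 2 (L2 negHalf × L2 posHalf)

/-! ### Weak derivatives and Sobolev spaces -/

/-- `g` is the weak derivative of `f` on `Ω`:
`∫ f φ' = - ∫ g φ` for every `φ ∈ C_c^∞(Ω)`. -/
def HasWeakDeriv (Ω : Opens ℝ) (f g : L2 Ω) : Prop :=
  ∀ φ : 𝓓(Ω, ℂ), ∫ x in (Ω : Set ℝ), f x * deriv φ x = -∫ x in (Ω : Set ℝ), g x * φ x

theorem test_memLp {Ω : Opens ℝ} (φ : 𝓓(Ω, ℂ)) :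
    MemLp φ 2 (volume.restrict (Ω : Set ℝ)) :=
  φ.continuous.memLp_of_hasCompactSupport φ.hasCompactSupport

theorem integrable_mul_test {Ω : Opens ℝ} (f : L2 Ω) {φ : ℝ → ℂ} (hφ : Continuous φ)
    (hc : HasCompactSupport φ) :
    Integrable (fun x => f x * φ x) (volume.restrict (Ω : Set ℝ)) :=
  (Lp.memLp f).integrable_mul (q := 2) (hφ.memLp_of_hasCompactSupport hc)

theorem deriv_test_continuous {Ω : Opens ℝ} (φ : 𝓓(Ω, ℂ)) : Continuous (deriv φ) :=
  φ.contDiff.continuous_deriv (by simp)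

theorem HasWeakDeriv.add {Ω : Opens ℝ} {f g f' g' : L2 Ω} (hf : HasWeakDeriv Ω f f')
    (hg : HasWeakDeriv Ω g g') : HasWeakDeriv Ω (f + g) (f' + g') := by
  intro φ
  have h1 : ∫ x in (Ω : Set ℝ), (f + g : L2 Ω) x * deriv φ x
      = ∫ x in (Ω : Set ℝ), (f x * deriv φ x + g x * deriv φ x) := by
    refine integral_congr_ae ?_
    filter_upwards [Lp.coeFn_add f g] with x hx
    rw [hx, Pi.add_apply, add_mul]
  have h2 : ∫ x in (Ω : Set ℝ), (f' + g' : L2 Ω) x * φ x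
      = ∫ x in (Ω : Set ℝ), (f' x * φ x + g' x * φ x) := by
    refine integral_congr_ae ?_
    filter_upwards [Lp.coeFn_add f' g'] with x hx
    rw [hx, Pi.add_apply, add_mul]
  have c1 := deriv_test_continuous φ
  have c2 := φ.hasCompactSupport.deriv
  rw [h1, h2, integral_add (integrable_mul_test f c1 c2) (integrable_mul_test g c1 c2),
    integral_add (integrable_mul_test f' φ.continuous φ.hasCompactSupport)
      (integrable_mul_test g' φ.continuous φ.hasCompactSupport), hf φ, hg φ, neg_add]

theorem HasWeakDeriv.smul {Ω : Opens ℝ} {f f' : L2 Ω} (c : ℂ) (hf : HasWeakDeriv Ω f f') :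
    HasWeakDeriv Ω (c • f) (c • f') := by
  intro φ
  have h1 : ∫ x in (Ω : Set ℝ), (c • f : L2 Ω) x * deriv φ x
      = ∫ x in (Ω : Set ℝ), c * (f x * deriv φ x) := by
    refine integral_congr_ae ?_
    filter_upwards [Lp.coeFn_smul c f] with x hx
    rw [hx, Pi.smul_apply, smul_eq_mul, mul_assoc]
  have h2 : ∫ x in (Ω : Set ℝ), (c • f' : L2 Ω) x * φ x
      = ∫ x in (Ω : Set ℝ), c * (f' x * φ x) := by
    refine integral_congr_ae ?_
    filter_upwards [Lp.coeFn_smul c f'] with x hx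
    rw [hx, Pi.smul_apply, smul_eq_mul, mul_assoc]
  rw [h1, h2, integral_const_mul, integral_const_mul, hf φ, mul_neg]

theorem hasWeakDeriv_zero (Ω : Opens ℝ) : HasWeakDeriv Ω 0 0 := by
  intro φ
  have h : ∀ ψ : ℝ → ℂ, ∫ x in (Ω : Set ℝ), (0 : L2 Ω) x * ψ x = 0 := by
    intro ψ
    refine integral_eq_zero_of_ae ?_
    filter_upwards [Lp.coeFn_zero ℂ 2 (volume.restrict (Ω : Set ℝ))] with x hx
    rw [hx]
    simp
  rw [h, h, neg_zero]

theorem HasWeakDeriv.unique {Ω : Opens ℝ} {f g h : L2 Ω} (hg : HasWeakDeriv Ω f g)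
    (hh : HasWeakDeriv Ω f h) : g = h := by
  have key : ∀ᵐ x, x ∈ (Ω : Set ℝ) → g x - h x = 0 := by
    refine Ω.isOpen.ae_eq_zero_of_integral_contDiff_smul_eq_zero ?_ ?_
    · have : LocallyIntegrable (fun x => g x - h x) (volume.restrict (Ω : Set ℝ)) :=
        ((Lp.memLp g).sub (Lp.memLp h)).locallyIntegrable (by norm_num)
      exact locallyIntegrableOn_of_locallyIntegrable_restrict this
    · intro ψ hψ hc hs
      have hc' : HasCompactSupport (fun x => (ψ x : ℂ)) := hc.comp_left (g := Complex.ofReal) rfl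
      have hs' : tsupport (fun x => (ψ x : ℂ)) ⊆ Ω :=
        (closure_mono (fun x hx => by
          simpa [Function.mem_support] using hx)).trans hs
      let φ : 𝓓(Ω, ℂ) := ⟨fun x => (ψ x : ℂ), by
        exact Complex.ofRealCLM.contDiff.comp hψ, hc', hs'⟩
      have e : ∫ x in (Ω : Set ℝ), g x * φ x = ∫ x in (Ω : Set ℝ), h x * φ x :=
        neg_injective ((hg φ).symm.trans (hh φ))
      have e2 : ∫ x in (Ω : Set ℝ), ψ x • (g x - h x) = 0 := by
        rw [← sub_eq_zero, ← integral_sub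
          (integrable_mul_test g φ.continuous φ.hasCompactSupport)
          (integrable_mul_test h φ.continuous φ.hasCompactSupport)] at e
        rw [← e]
        refine integral_congr_ae (Eventually.of_forall fun x => ?_)
        change ψ x • (g x - h x) = g x * (ψ x : ℂ) - h x * (ψ x : ℂ)
        rw [Complex.real_smul]
        ring
      rw [← e2, setIntegral_eq_integral_of_forall_compl_eq_zero]
      intro x hx
      have : ψ x = 0 := image_eq_zero_of_notMem_tsupport fun hxs => hx (hs hxs)
      rw [this, zero_smul]
  refine Lp.ext ?_
  filter_upwards [(ae_restrict_iff' Ω.isOpen.measurableSet).2 key] with x hx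
  exact sub_eq_zero.1 hx

/-- The functions in `L²(Ω)` that have a weak derivative in the subspace `S`. -/
def weakDerivIn (Ω : Opens ℝ) (S : Submodule ℂ (L2 Ω)) : Submodule ℂ (L2 Ω) where
  carrier := {f | ∃ g ∈ S, HasWeakDeriv Ω f g}
  add_mem' := fun ⟨a, ha, ha'⟩ ⟨b, hb, hb'⟩ => ⟨a + b, add_mem ha hb, ha'.add hb'⟩
  zero_mem' := ⟨0, zero_mem _, hasWeakDeriv_zero Ω⟩
  smul_mem' := fun c _ ⟨a, ha, ha'⟩ => ⟨c • a, Submodule.smul_mem _ c ha, ha'.smul c⟩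

/-- The Sobolev space `H^n(Ω)`: the `L²` functions whose weak derivatives up to order `n`
exist in `L²`; so `H^0 = L²` and `f ∈ H^(n+1)` if and only if `f` has a weak derivative
in `H^n`. -/
def sobolev (Ω : Opens ℝ) : ℕ → Submodule ℂ (L2 Ω)
  | 0 => ⊤
  | n + 1 => weakDerivIn Ω (sobolev Ω n)

open Classical in
/-- The weak derivative of `f` (with the junk value `0` if `f ∉ H¹(Ω)`). -/
def weakDeriv (Ω : Opens ℝ) (f : L2 Ω) : L2 Ω :=
  if h : ∃ g, HasWeakDeriv Ω f g then h.choose else 0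

theorem HasWeakDeriv.weakDeriv_eq {Ω : Opens ℝ} {f g : L2 Ω} (h : HasWeakDeriv Ω f g) :
    weakDeriv Ω f = g := by
  have h' : ∃ g, HasWeakDeriv Ω f g := ⟨g, h⟩
  rw [weakDeriv, dif_pos h']
  exact h'.choose_spec.unique h

theorem weakDeriv_mem {Ω : Opens ℝ} {n : ℕ} {f : L2 Ω} (hf : f ∈ sobolev Ω (n + 1)) :
    weakDeriv Ω f ∈ sobolev Ω n := by
  obtain ⟨g, hg, h⟩ := hf
  rwa [h.weakDeriv_eq]

theorem weakDeriv_add {Ω : Opens ℝ} {n : ℕ} {f g : L2 Ω} (hf : f ∈ sobolev Ω (n + 1))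
    (hg : g ∈ sobolev Ω (n + 1)) :
    weakDeriv Ω (f + g) = weakDeriv Ω f + weakDeriv Ω g := by
  obtain ⟨a, -, ha⟩ := hf
  obtain ⟨b, -, hb⟩ := hg
  rw [(ha.add hb).weakDeriv_eq, ha.weakDeriv_eq, hb.weakDeriv_eq]

theorem weakDeriv_smul {Ω : Opens ℝ} {n : ℕ} (c : ℂ) {f : L2 Ω} (hf : f ∈ sobolev Ω (n + 1)) :
    weakDeriv Ω (c • f) = c • weakDeriv Ω f := by
  obtain ⟨a, -, ha⟩ := hf
  rw [(ha.smul c).weakDeriv_eq, ha.weakDeriv_eq]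

/-- The `j`-th weak derivative of `f`, meaningful for `f ∈ H^j(Ω)`. -/
def iterWeakDeriv (Ω : Opens ℝ) : ℕ → L2 Ω → L2 Ω
  | 0, f => f
  | j + 1, f => iterWeakDeriv Ω j (weakDeriv Ω f)

theorem iterWeakDeriv_add {Ω : Opens ℝ} (j : ℕ) {n : ℕ} (hj : j ≤ n) {f g : L2 Ω}
    (hf : f ∈ sobolev Ω n) (hg : g ∈ sobolev Ω n) :
    iterWeakDeriv Ω j (f + g) = iterWeakDeriv Ω j f + iterWeakDeriv Ω j g := by
  induction j generalizing n f g with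
  | zero => rfl
  | succ j ih =>
    obtain ⟨m, rfl⟩ : ∃ m, n = m + 1 := ⟨n - 1, by omega⟩
    simp only [iterWeakDeriv]
    rw [weakDeriv_add hf hg, ih (by omega) (weakDeriv_mem hf) (weakDeriv_mem hg)]

theorem iterWeakDeriv_smul {Ω : Opens ℝ} (j : ℕ) {n : ℕ} (hj : j ≤ n) (c : ℂ) {f : L2 Ω}
    (hf : f ∈ sobolev Ω n) :
    iterWeakDeriv Ω j (c • f) = c • iterWeakDeriv Ω j f := by
  induction j generalizing n f with
  | zero => rfl
  | succ j ih =>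
    obtain ⟨m, rfl⟩ : ∃ m, n = m + 1 := ⟨n - 1, by omega⟩
    simp only [iterWeakDeriv]
    rw [weakDeriv_smul c hf, ih (by omega) (weakDeriv_mem hf)]

/-! ### Boundary values at the vertex -/

/-- `f(0±) = c`: the representative of `f` that is continuous on the half-line `Ω` tends to `c`
at the vertex `0`. -/
def HasBoundaryValue (Ω : Opens ℝ) (f : L2 Ω) (c : ℂ) : Prop :=
  ∃ g : ℝ → ℂ, ContinuousOn g Ω ∧ f =ᵐ[volume.restrict (Ω : Set ℝ)] g ∧
    Tendsto g (𝓝[(Ω : Set ℝ)] 0) (𝓝 c)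

/-- `(f(0±), f'(0±), f''(0±)) = (a 0, a 1, a 2)`. For `f ∈ H³` of a half-line there is exactly one
such vector `a`. -/
def HasBoundaryData (Ω : Opens ℝ) (f : L2 Ω) (a : Fin 3 → ℂ) : Prop :=
  ∀ j : Fin 3, HasBoundaryValue Ω (iterWeakDeriv Ω j f) (a j)

theorem HasBoundaryValue.add {Ω : Opens ℝ} {f g : L2 Ω} {a b : ℂ} (hf : HasBoundaryValue Ω f a)
    (hg : HasBoundaryValue Ω g b) : HasBoundaryValue Ω (f + g) (a + b) := by
  obtain ⟨F, hF, hF', hF''⟩ := hf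
  obtain ⟨G, hG, hG', hG''⟩ := hg
  exact ⟨F + G, hF.add hG, (Lp.coeFn_add f g).trans (hF'.add hG'), hF''.add hG''⟩

theorem HasBoundaryValue.smul {Ω : Opens ℝ} {f : L2 Ω} {a : ℂ} (c : ℂ)
    (hf : HasBoundaryValue Ω f a) : HasBoundaryValue Ω (c • f) (c • a) := by
  obtain ⟨F, hF, hF', hF''⟩ := hf
  exact ⟨c • F, hF.const_smul c, (Lp.coeFn_smul c f).trans (hF'.const_smul c), hF''.const_smul c⟩

theorem HasBoundaryData.add {Ω : Opens ℝ} {f g : L2 Ω} {a b : Fin 3 → ℂ}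
    (hf : f ∈ sobolev Ω 3) (hg : g ∈ sobolev Ω 3) (ha : HasBoundaryData Ω f a)
    (hb : HasBoundaryData Ω g b) : HasBoundaryData Ω (f + g) (a + b) := by
  intro j
  rw [iterWeakDeriv_add j (by omega) hf hg]
  exact (ha j).add (hb j)

theorem HasBoundaryData.smul {Ω : Opens ℝ} {f : L2 Ω} {a : Fin 3 → ℂ} (c : ℂ)
    (hf : f ∈ sobolev Ω 3) (ha : HasBoundaryData Ω f a) :
    HasBoundaryData Ω (c • f) (c • a) := by
  intro j
  rw [iterWeakDeriv_smul j (by omega) c hf]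
  exact (ha j).smul c

theorem hasBoundaryData_zero (Ω : Opens ℝ) : HasBoundaryData Ω 0 0 := by
  have h0 : ∀ j, iterWeakDeriv Ω j 0 = 0 := by
    intro j
    have := iterWeakDeriv_smul (Ω := Ω) j le_rfl 0 (zero_mem (sobolev Ω j))
    simpa using this
  intro j
  rw [h0]
  exact ⟨0, continuousOn_const, Lp.coeFn_zero _ _ _, tendsto_const_nhds⟩

/-! ### The Airy operators on the graph with two half-lines -/

/-- The Airy operator on the graph, `u ↦ (α₋ u₋''' + β₋ u₋', α₊ u₊''' + β₊ u₊')` with weak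
derivatives, on the domain of all `u ∈ H³(-∞,0) ⊕ H³(0,+∞)` that satisfy the boundary relation
`L (u₋(0-), u₋'(0-), u₋''(0-)) = (u₊(0+), u₊'(0+), u₊''(0+))`. -/
def airyExt (αm αp βm βp : ℝ) (L : Matrix (Fin 3) (Fin 3) ℂ) : L2Graph →ₗ.[ℂ] L2Graph where
  domain :=
    { carrier := {u | u.fst ∈ sobolev negHalf 3 ∧ u.snd ∈ sobolev posHalf 3 ∧
        ∃ a b : Fin 3 → ℂ, HasBoundaryData negHalf u.fst a ∧ HasBoundaryData posHalf u.snd b ∧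
          L.mulVec a = b}
      add_mem' := by
        rintro u v ⟨hu, hu', a, b, ha, hb, hab⟩ ⟨hv, hv', c, d, hc, hd, hcd⟩
        refine ⟨add_mem hu hv, add_mem hu' hv', a + c, b + d, ha.add hu hv hc,
          hb.add hu' hv' hd, ?_⟩
        rw [Matrix.mulVec_add, hab, hcd]
      zero_mem' := ⟨zero_mem _, zero_mem _, 0, 0, hasBoundaryData_zero _, hasBoundaryData_zero _,
        Matrix.mulVec_zero L⟩
      smul_mem' := by
        rintro c u ⟨hu, hu', a, b, ha, hb, hab⟩
        refine ⟨Submodule.smul_mem _ c hu, Submodule.smul_mem _ c hu', c • a, c • b,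
          ha.smul c hu, hb.smul c hu', ?_⟩
        rw [Matrix.mulVec_smul, hab] }
  toFun :=
    { toFun := fun u => WithLp.toLp 2
        ((αm : ℂ) • iterWeakDeriv negHalf 3 u.1.fst + (βm : ℂ) • iterWeakDeriv negHalf 1 u.1.fst,
         (αp : ℂ) • iterWeakDeriv posHalf 3 u.1.snd + (βp : ℂ) • iterWeakDeriv posHalf 1 u.1.snd)
      map_add' := by
        rintro ⟨u, hu, hu', -⟩ ⟨v, hv, hv', -⟩
        change WithLp.toLp 2
          ((αm : ℂ) • iterWeakDeriv negHalf 3 (u.fst + v.fst)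
            + (βm : ℂ) • iterWeakDeriv negHalf 1 (u.fst + v.fst),
           (αp : ℂ) • iterWeakDeriv posHalf 3 (u.snd + v.snd)
            + (βp : ℂ) • iterWeakDeriv posHalf 1 (u.snd + v.snd)) = _
        rw [iterWeakDeriv_add 3 le_rfl hu hv, iterWeakDeriv_add 1 (by omega) hu hv,
          iterWeakDeriv_add 3 le_rfl hu' hv', iterWeakDeriv_add 1 (by omega) hu' hv',
          ← WithLp.toLp_add, Prod.mk_add_mk]
        congr 2 <;> module
      map_smul' := by
        rintro c ⟨u, hu, hu', -⟩
        change WithLp.toLp 2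
          ((αm : ℂ) • iterWeakDeriv negHalf 3 (c • u.fst)
            + (βm : ℂ) • iterWeakDeriv negHalf 1 (c • u.fst),
           (αp : ℂ) • iterWeakDeriv posHalf 3 (c • u.snd)
            + (βp : ℂ) • iterWeakDeriv posHalf 1 (c • u.snd)) = _
        rw [iterWeakDeriv_smul 3 le_rfl c hu, iterWeakDeriv_smul 1 (by omega) c hu,
          iterWeakDeriv_smul 3 le_rfl c hu', iterWeakDeriv_smul 1 (by omega) c hu',
          RingHom.id_apply, ← WithLp.toLp_smul, Prod.smul_mk]
        congr 2 <;> module }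

/-- The derivative `φ ↦ φ'` on `C_c^∞(Ω)`. -/
def testDeriv (Ω : Opens ℝ) : 𝓓(Ω, ℂ) →ₗ[ℂ] 𝓓(Ω, ℂ) where
  toFun φ := ⟨deriv φ, by
      have h : ContDiff ℝ ∞ (deriv φ) := (contDiff_infty_iff_deriv.1 φ.contDiff).2
      exact h, φ.hasCompactSupport.deriv,
    (closure_minimal (support_deriv_subset) (isClosed_tsupport _)).trans φ.tsupport_subset⟩
  map_add' φ ψ := by
    ext x
    exact deriv_add ((φ.contDiff.differentiable (by simp)) x)
      ((ψ.contDiff.differentiable (by simp)) x)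
  map_smul' c φ := by
    ext x
    exact deriv_const_smul c ((φ.contDiff.differentiable (by simp)) x)

/-- The inclusion of `C_c^∞(Ω)` in `L²(Ω)`. -/
def testToL2 (Ω : Opens ℝ) : 𝓓(Ω, ℂ) →ₗ[ℂ] L2 Ω where
  toFun φ := (test_memLp φ).toLp φ
  map_add' _ _ := rfl
  map_smul' _ _ := rfl

theorem testToL2_injective (Ω : Opens ℝ) : Function.Injective (testToL2 Ω) := by
  intro φ ψ h
  have h1 : φ =ᵐ[volume.restrict (Ω : Set ℝ)] ψ :=
    (MemLp.toLp_eq_toLp_iff (test_memLp φ) (test_memLp ψ)).1 h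
  have h2 := Measure.eqOn_open_of_ae_eq h1 Ω.isOpen φ.continuous.continuousOn
    ψ.continuous.continuousOn
  ext x
  by_cases hx : x ∈ (Ω : Set ℝ)
  · exact h2 hx
  · rw [image_eq_zero_of_notMem_tsupport fun hxs => hx (φ.tsupport_subset hxs),
      image_eq_zero_of_notMem_tsupport fun hxs => hx (ψ.tsupport_subset hxs)]

/-- The inclusion of `C_c^∞(-∞,0) ⊕ C_c^∞(0,+∞)` in `L²` of the graph. -/
def testToL2Graph : 𝓓(negHalf, ℂ) × 𝓓(posHalf, ℂ) →ₗ[ℂ] L2Graph :=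
  (WithLp.linearEquiv 2 ℂ (L2 negHalf × L2 posHalf)).symm.toLinearMap ∘ₗ
    (testToL2 negHalf).prodMap (testToL2 posHalf)

theorem testToL2Graph_injective : Function.Injective testToL2Graph :=
  (WithLp.linearEquiv 2 ℂ (L2 negHalf × L2 posHalf)).symm.injective.comp
    ((testToL2_injective negHalf).prodMap (testToL2_injective posHalf))

/-- `φ ↦ α φ''' + β φ'` on `C_c^∞(Ω)`. -/
def testAiry (Ω : Opens ℝ) (α β : ℝ) : 𝓓(Ω, ℂ) →ₗ[ℂ] 𝓓(Ω, ℂ) :=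
  (α : ℂ) • (testDeriv Ω ∘ₗ testDeriv Ω ∘ₗ testDeriv Ω) + (β : ℂ) • testDeriv Ω

/-- The Airy operator `A₀`: `u ↦ (α₋ u₋''' + β₋ u₋', α₊ u₊''' + β₊ u₊')` on the domain
`C_c^∞(-∞,0) ⊕ C_c^∞(0,+∞)`. -/
def airyMin (αm αp βm βp : ℝ) : L2Graph →ₗ.[ℂ] L2Graph where
  domain := LinearMap.range testToL2Graph
  toFun := testToL2Graph ∘ₗ (testAiry negHalf αm βm).prodMap (testAiry posHalf αp βp) ∘ₗ
    (LinearEquiv.ofInjective testToL2Graph testToL2Graph_injective).symm.toLinearMap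

/-- A densely defined operator `A` on a Hilbert space is skew-self-adjoint if `A* = -A`
(with equality of domains). -/
def IsSkewSelfAdjoint {H : Type*} [NormedAddCommGroup H] [InnerProductSpace ℂ H] [CompleteSpace H]
    (A : H →ₗ.[ℂ] H) : Prop :=
  Dense (A.domain : Set H) ∧ A† = -A

/-- The matrix `L_Z`. -/
def LZ (Z : ℝ) : Matrix (Fin 3) (Fin 3) ℂ :=
  !![1, 0, 0;
     (Z : ℂ), 1, 0;
     (Z : ℂ) ^ 2 / 2, (Z : ℂ), 1]

/-- The operator `A_Z`, given by the boundary relation of `L_Z`. -/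
def airyDelta (αm αp βm βp Z : ℝ) : L2Graph →ₗ.[ℂ] L2Graph :=
  airyExt αm αp βm βp (LZ Z)

end AiryGraph

end

noncomputable section

namespace AiryGraph

/-! ### Primitives of locally integrable functions -/

/-! Everything about skew-self-adjointness is read off from Green's formula (`airyExt_green`): for
`u` in the domain and `v` in `H³` of both half-lines, `⟪v, Au⟫ + ⟪Av, u⟫` is the difference of the
boundary forms of the two half-lines, evaluated on the 2-jets at the vertex. Hence the operator of a
boundary matrix `L` is skew-symmetric exactly if `L` carries one form to the other. If moreover `L`
is surjective, then the nondegeneracy of the form (`boundaryForm_left_injective`) forces the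
boundary relation on each element of the adjoint domain, so that skew-symmetry already gives `A† =
-A` (`isSkewSelfAdjoint_airyExt_iff`). The matrix `L_Z` preserves the form for any coefficients
(`boundaryForm_LZ`), so what remains is equality of the forms with coefficients `(α₋, β₋)` and `(α₊,
β₊)`, that is, of the coefficients.

The analytic core is that elements of the adjoint domain lie in `H³` (`airy_regularity`). They solve
`α v''' + β v' = -w` in the distributional sense. Integrating three times gives continuous `P`, `N`,
`M` with `P' = -w`, `N' = P - β v`, `M' = N`, `M = α v`. Only `M` is visibly in `L²`; Taylor's
formula with steps 1 and 2 recovers `P` and `N` from translates of `M`, up to errors controlled by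
moving averages of `L²` functions (`prim_taylor`, `memLp_prim_Ioi`).

Sobolev functions are handled throughout as primitives `prim c h`, where `c` is the boundary value
at the vertex and `h` the weak derivative extended by zero. In this form, `H¹` functions with equal
boundary values glue at once, since they are primitives with the same constant. -/

theorem intervalIntegrable_of_loc {h : ℝ → ℂ} (hh : LocallyIntegrable h) (a b : ℝ) :
    IntervalIntegrable h volume a b :=
  intervalIntegrable_iff.mpr <|
    (hh.integrableOn_isCompact isCompact_uIcc).mono_set Set.uIoc_subset_uIcc

/-- The primitive of `h` with value `c` at `0`. -/
def prim (c : ℂ) (h : ℝ → ℂ) (x : ℝ) : ℂ := c + ∫ t in (0 : ℝ)..x, h t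

@[simp] theorem prim_zero (c : ℂ) (h : ℝ → ℂ) : prim c h 0 = c := by simp [prim]

theorem prim_sub {h : ℝ → ℂ} (hh : LocallyIntegrable h) (c : ℂ) (x y : ℝ) :
    prim c h y - prim c h x = ∫ t in x..y, h t := by
  have := intervalIntegral.integral_add_adjacent_intervals
    (intervalIntegrable_of_loc hh 0 x) (intervalIntegrable_of_loc hh x y)
  simp only [prim, ← this]
  ring

theorem prim_continuous {h : ℝ → ℂ} (hh : LocallyIntegrable h) (c : ℂ) :
    Continuous (prim c h) :=
  continuous_const.add
    (intervalIntegral.continuous_primitive (intervalIntegrable_of_loc hh) 0)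

/-- Reduces to real-valued integrands by splitting into real and imaginary parts. The interval is
enlarged to `[A, B]` so that it contains the base point `c`. -/
theorem absolutelyContinuous_primitive {h : ℝ → ℂ} (hh : LocallyIntegrable h) (a b c : ℝ) :
    AbsolutelyContinuousOnInterval (fun x => ∫ t in c..x, h t) a b := by
  set A := min a (min b c)
  set B := max a (max b c)
  have hA : A ≤ B := by grind
  have hc : c ∈ Set.uIcc A B := by rw [Set.uIcc_of_le hA]; constructor <;> grind
  have hab : Set.uIcc a b ⊆ Set.uIcc A B := by
    rw [Set.uIcc_of_le hA]; exact Set.uIcc_subset_Icc (by constructor <;> grind)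
      (by constructor <;> grind)
  have hi := intervalIntegrable_of_loc hh A B
  have hre : IntervalIntegrable (fun x => (h x).re) volume A B := ⟨hi.1.re, hi.2.re⟩
  have him : IntervalIntegrable (fun x => (h x).im) volume A B := ⟨hi.1.im, hi.2.im⟩
  have e : (fun x => ∫ t in c..x, h t) =
      (fun x => (∫ t in c..x, (h t).re) • (1 : ℂ)) + fun x => (∫ t in c..x, (h t).im) • Complex.I := by
    funext x
    have hx := intervalIntegrable_of_loc hh c x
    have h1 : (∫ t in c..x, (h t).re) = (∫ t in c..x, h t).re :=
      Complex.reCLM.intervalIntegral_comp_comm hx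
    have h2 : (∫ t in c..x, (h t).im) = (∫ t in c..x, h t).im :=
      Complex.imCLM.intervalIntegral_comp_comm hx
    simp only [Pi.add_apply, h1, h2, Complex.real_smul, mul_one]
    exact (Complex.re_add_im _).symm
  have hconst : ∀ z : ℂ, AbsolutelyContinuousOnInterval (fun _ : ℝ => z) A B := fun z =>
    (LipschitzWith.const z).lipschitzOnWith.absolutelyContinuousOnInterval
  rw [e]
  refine AbsolutelyContinuousOnInterval.mono ?_ hab
  exact ((hre.absolutelyContinuousOnInterval_intervalIntegral hc).smul (hconst 1)).add
    ((him.absolutelyContinuousOnInterval_intervalIntegral hc).smul (hconst Complex.I))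

theorem absolutelyContinuous_prim {h : ℝ → ℂ} (hh : LocallyIntegrable h) (c : ℂ) (a b : ℝ) :
    AbsolutelyContinuousOnInterval (prim c h) a b :=
  AbsolutelyContinuousOnInterval.add
    ((LipschitzWith.const c).lipschitzOnWith.absolutelyContinuousOnInterval)
    (absolutelyContinuous_primitive hh a b 0)

theorem locallyIntegrable_mul {f g : ℝ → ℂ} (hf : LocallyIntegrable f) (hg : Continuous g) :
    LocallyIntegrable fun x => f x * g x := by
  have := hf.smul_continuous hg
  exact this

/-- The product rule for primitives of locally integrable functions. -/
theorem prim_mul {f g : ℝ → ℂ} (hf : LocallyIntegrable f) (hg : LocallyIntegrable g)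
    (c d : ℂ) (x : ℝ) : prim c f x * prim d g x =
      prim (c * d) (fun t => f t * prim d g t + g t * prim c f t) x := by
  set k : ℝ → ℂ := fun t => f t * prim d g t + g t * prim c f t
  have hk : LocallyIntegrable k :=
    (locallyIntegrable_mul hf (prim_continuous hg d)).add
      (locallyIntegrable_mul hg (prim_continuous hf c))
  -- The difference of the two sides is absolutely continuous with derivative zero almost
  -- everywhere, hence constant, and it vanishes at `0`.
  have hac : AbsolutelyContinuousOnInterval
      (prim c f • prim d g - prim (c * d) k) 0 x :=
    ((absolutelyContinuous_prim hf c 0 x).smul (absolutelyContinuous_prim hg d 0 x)).sub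
      (absolutelyContinuous_prim hk _ 0 x)
  obtain ⟨C, hC⟩ := hac.const_of_ae_hasDerivAt_zero (by
    filter_upwards [_root_.LocallyIntegrable.ae_hasDerivAt_integral hf, _root_.LocallyIntegrable.ae_hasDerivAt_integral hg,
      _root_.LocallyIntegrable.ae_hasDerivAt_integral hk] with y h1 h2 h3 _
    have := ((((h1 0).const_add c).mul ((h2 0).const_add d))).sub ((h3 0).const_add (c * d))
    have e : f y * (d + ∫ t in (0 : ℝ)..y, g t) + (c + ∫ t in (0 : ℝ)..y, f t) * g y - k y = 0 := by
      simp only [k, prim]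
      ring
    rw [e] at this
    exact this)
  have h0 := hC 0 Set.left_mem_uIcc
  have hx := hC x Set.right_mem_uIcc
  simp only [Pi.sub_apply, Pi.mul_apply, prim_zero, smul_eq_mul] at h0 hx
  rw [← h0, sub_self, sub_eq_zero] at hx
  exact hx

theorem prim_deriv {φ : ℝ → ℂ} (hφ : ContDiff ℝ 1 φ) : prim (φ 0) (deriv φ) = φ := by
  funext x
  rw [prim, intervalIntegral.integral_deriv_eq_sub]
  · ring
  · exact fun y _ => hφ.differentiable one_ne_zero y
  · exact (hφ.continuous_deriv le_rfl).intervalIntegrable _ _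

/-! ### The lemma of du Bois-Reymond -/

theorem test_eq_zero {Ω : Opens ℝ} (φ : 𝓓(Ω, ℂ)) {x : ℝ} (hx : x ∉ (Ω : Set ℝ)) : φ x = 0 :=
  image_eq_zero_of_notMem_tsupport fun h => hx (φ.tsupport_subset h)

@[simp] theorem testDeriv_apply {Ω : Opens ℝ} (φ : 𝓓(Ω, ℂ)) (x : ℝ) :
    testDeriv Ω φ x = deriv φ x := rfl

theorem test_bounded {Ω : Opens ℝ} (φ : 𝓓(Ω, ℂ)) :
    ∃ R : ℝ, 0 < R ∧ tsupport φ ⊆ Set.Ioo (-R) R := by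
  obtain ⟨R, hR, h⟩ := φ.hasCompactSupport.isCompact.isBounded.subset_ball_lt 0 0
  refine ⟨R, hR, h.trans ?_⟩
  rw [Real.ball_eq_Ioo]
  simp

theorem setIntegral_mul_test {Ω : Opens ℝ} (f : ℝ → ℂ) (φ : 𝓓(Ω, ℂ)) :
    ∫ x in (Ω : Set ℝ), f x * φ x = ∫ x, f x * φ x :=
  setIntegral_eq_integral_of_forall_compl_eq_zero fun x hx => by rw [test_eq_zero φ hx, mul_zero]

theorem integrable_mul_test_of_loc {Ω : Opens ℝ} {f : ℝ → ℂ} (hf : LocallyIntegrable f)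
    (φ : 𝓓(Ω, ℂ)) : Integrable fun x => f x * φ x := by
  have := hf.integrable_smul_right_of_hasCompactSupport φ.continuous φ.hasCompactSupport
  simpa using this

/-- Primitives are weak antiderivatives. -/
theorem integral_prim_mul_deriv {Ω : Opens ℝ} {h : ℝ → ℂ} (hh : LocallyIntegrable h) (c : ℂ)
    (φ : 𝓓(Ω, ℂ)) : ∫ x in (Ω : Set ℝ), prim c h x * deriv φ x
      = -∫ x in (Ω : Set ℝ), h x * φ x := by
  have e := setIntegral_mul_test (prim c h) (testDeriv Ω φ)
  simp only [testDeriv_apply] at e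
  rw [e, setIntegral_mul_test]
  obtain ⟨R, hR, hs⟩ := test_bounded φ
  have z : ∀ x, x ∉ Set.Ioo (-R) R → φ x = 0 := fun x hx =>
    image_eq_zero_of_notMem_tsupport fun h => hx (hs h)
  have z' : ∀ x, x ∉ Set.Ioo (-R) R → deriv φ x = 0 := fun x hx =>
    image_eq_zero_of_notMem_tsupport fun h => hx (hs (tsupport_deriv_subset h))
  have i1 : ∫ x in (-R)..R, prim c h x * deriv φ x = ∫ x, prim c h x * deriv φ x :=
    intervalIntegral.integral_eq_integral_of_support_subset fun x hx => by
      by_contra h'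
      refine hx ?_
      change prim c h x * deriv φ x = 0
      rw [z' x fun h'' => h' ⟨h''.1, h''.2.le⟩, mul_zero]
  have i2 : ∫ x in (-R)..R, h x * φ x = ∫ x, h x * φ x :=
    intervalIntegral.integral_eq_integral_of_support_subset fun x hx => by
      by_contra h'
      refine hx ?_
      change h x * φ x = 0
      rw [z x fun h'' => h' ⟨h''.1, h''.2.le⟩, mul_zero]
  have hφ : ContDiff ℝ 1 φ := φ.contDiff.of_le (by simp)
  have hd : LocallyIntegrable (deriv φ) := (deriv_test_continuous φ).locallyIntegrable
  have j1 : LocallyIntegrable fun x => h x * φ x := locallyIntegrable_mul hh φ.continuous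
  have j2 : LocallyIntegrable fun x => deriv φ x * prim c h x :=
    locallyIntegrable_mul hd (prim_continuous hh c)
  -- The product `prim c h * φ` vanishes at `±R`, so its derivative has integral zero over `(-R,
  -- R)`.
  have p1 := prim_mul hh hd c (φ 0) R
  have p2 := prim_mul hh hd c (φ 0) (-R)
  rw [prim_deriv hφ] at p1 p2
  rw [z R (by simp), mul_zero] at p1
  rw [z (-R) (by simp), mul_zero] at p2
  have := prim_sub (h := fun t => h t * φ t + deriv φ t * prim c h t) (j1.add j2)
    (c * φ 0) (-R) R
  rw [← p1, ← p2, intervalIntegral.integral_add (intervalIntegrable_of_loc j1 _ _)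
    (intervalIntegrable_of_loc j2 _ _), i2] at this
  simp only [mul_comm (deriv φ _), i1] at this
  linear_combination -this

/-- The primitive from the left of the support vanishes to the right of it because the total
integral is zero. Order-connectedness keeps the convex hull `[a, b]` of the support inside `Ω`. -/
theorem exists_test_deriv_eq {Ω : Opens ℝ} (hΩ : (Ω : Set ℝ).OrdConnected) (θ : 𝓓(Ω, ℂ))
    (hθ : ∫ x, θ x = 0) : ∃ ψ : 𝓓(Ω, ℂ), testDeriv Ω ψ = θ := by
  rcases (tsupport θ).eq_empty_or_nonempty with h0 | hne
  · refine ⟨0, ?_⟩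
    rw [map_zero]
    ext x
    exact (image_eq_zero_of_notMem_tsupport (by simp [h0])).symm
  have hc : IsCompact (tsupport θ) := θ.hasCompactSupport
  obtain ⟨a, ha, hamin⟩ := hc.exists_isLeast hne
  obtain ⟨b, hb, hbmax⟩ := hc.exists_isGreatest hne
  have hab : Set.Icc a b ⊆ Ω := hΩ.out (θ.tsupport_subset ha) (θ.tsupport_subset hb)
  have z : ∀ x, x ∉ Set.Icc a b → θ x = 0 := fun x hx =>
    image_eq_zero_of_notMem_tsupport fun h => hx ⟨hamin h, hbmax h⟩
  have hii : ∀ x y, IntervalIntegrable θ volume x y := fun x y => θ.continuous.intervalIntegrable x y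
  let f : ℝ → ℂ := fun x => ∫ t in (a - 1)..x, θ t
  have hd : deriv f = θ := by
    funext x
    exact (θ.continuous.integral_hasStrictDerivAt (a - 1) x).hasDerivAt.deriv
  have hf : ContDiff ℝ ∞ f := by
    refine contDiff_infty_iff_deriv.2 ⟨fun x =>
      (θ.continuous.integral_hasStrictDerivAt (a - 1) x).hasDerivAt.differentiableAt, ?_⟩
    rw [hd]
    exact θ.contDiff
  have hs : Function.support f ⊆ Set.Icc a b := by
    intro x hx
    by_contra hx'
    refine hx ?_
    rcases lt_or_ge x a with h | h
    · refine intervalIntegral.integral_zero_ae (Eventually.of_forall fun t ht => z t fun h' => ?_)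
      have : t ≤ max (a - 1) x := ht.2
      have := h'.1
      grind
    · have hbx : b < x := by
        by_contra hbx
        exact hx' ⟨h, not_lt.1 hbx⟩
      change ∫ t in (a - 1)..x, θ t = 0
      rw [← hθ]
      refine intervalIntegral.integral_eq_integral_of_support_subset fun t ht => ?_
      have : t ∈ Set.Icc a b := by
        by_contra h'
        exact ht (z t h')
      exact ⟨by linarith [this.1], this.2.trans hbx.le⟩
  have hts : tsupport f ⊆ Set.Icc a b := closure_minimal hs isClosed_Icc
  refine ⟨⟨f, hf, HasCompactSupport.of_support_subset_isCompact isCompact_Icc hs,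
    hts.trans hab⟩, ?_⟩
  ext x
  exact congrFun hd x

theorem exists_test_integral_eq_one {Ω : Opens ℝ} (hne : (Ω : Set ℝ).Nonempty) :
    ∃ φ : 𝓓(Ω, ℂ), ∫ x, φ x = 1 := by
  obtain ⟨x, hx⟩ := hne
  obtain ⟨f, hfs, hfc, hfd, hfr, hfx⟩ :=
    exists_contDiff_tsupport_subset (n := ⊤) (Ω.isOpen.mem_nhds hx)
  have hpos : 0 < ∫ y, f y := by
    refine (integral_pos_iff_support_of_nonneg (fun y => (hfr ⟨y, rfl⟩).1)
      (hfd.continuous.integrable_of_hasCompactSupport hfc)).2 ?_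
    exact hfd.continuous.isOpen_support.measure_pos _ ⟨x, by simp [hfx]⟩
  have hs : tsupport (fun y => (f y : ℂ)) ⊆ Ω :=
    (closure_mono fun y hy => by simpa [Function.mem_support] using hy).trans hfs
  let φ : 𝓓(Ω, ℂ) := ⟨fun y => (f y : ℂ), Complex.ofRealCLM.contDiff.comp hfd,
    hfc.comp_left (g := Complex.ofReal) rfl, hs⟩
  refine ⟨((∫ y, f y : ℝ) : ℂ)⁻¹ • φ, ?_⟩
  have e : ∫ y, φ y = ((∫ y, f y : ℝ) : ℂ) := integral_ofReal
  change ∫ y, ((∫ y, f y : ℝ) : ℂ)⁻¹ • φ y = 1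
  rw [integral_smul, e, smul_eq_mul, inv_mul_cancel₀]
  exact_mod_cast hpos.ne'

/-- A functional on test functions whose derivative is a locally integrable function is given by
a primitive of this function. -/
theorem exists_prim_of_deriv {Ω : Opens ℝ} (hΩ : (Ω : Set ℝ).OrdConnected)
    (hne : (Ω : Set ℝ).Nonempty) {h : ℝ → ℂ} (hh : LocallyIntegrable h) (T : 𝓓(Ω, ℂ) →ₗ[ℂ] ℂ)
    (hT : ∀ φ, T (testDeriv Ω φ) = -∫ x in (Ω : Set ℝ), h x * φ x) :
    ∃ c, ∀ ψ, T ψ = ∫ x in (Ω : Set ℝ), prim c h x * ψ x := by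
  obtain ⟨φ₀, h₀⟩ := exists_test_integral_eq_one hne
  have hp : LocallyIntegrable (prim 0 h) := (prim_continuous hh 0).locallyIntegrable
  have hint : ∀ ψ : 𝓓(Ω, ℂ), Integrable ψ := fun ψ =>
    ψ.continuous.integrable_of_hasCompactSupport ψ.hasCompactSupport
  refine ⟨T φ₀ - ∫ x in (Ω : Set ℝ), prim 0 h x * φ₀ x, fun ψ => ?_⟩
  set m := ∫ x, ψ x
  -- Subtracting `m` times a test function of integral one leaves mean zero, hence a derivative, on
  -- which `T` is known. The value `T φ₀` then fixes the constant of integration.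
  obtain ⟨χ, hχ⟩ := exists_test_deriv_eq hΩ (ψ - m • φ₀) (by
    change ∫ x, (ψ x - m • φ₀ x) = 0
    have hm : Integrable fun x => m • φ₀ x := (hint φ₀).smul m
    rw [integral_sub (hint ψ) hm, integral_smul, h₀]
    simp [m])
  have h1 := hT χ
  rw [← integral_prim_mul_deriv hh 0 χ] at h1
  have h2 : ∫ x in (Ω : Set ℝ), prim 0 h x * deriv χ x =
      (∫ x, prim 0 h x * ψ x) - m * ∫ x, prim 0 h x * φ₀ x := by
    have := setIntegral_mul_test (prim 0 h) (testDeriv Ω χ)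
    simp only [testDeriv_apply] at this
    rw [this, ← integral_const_mul, ← integral_sub (integrable_mul_test_of_loc hp ψ)
      ((integrable_mul_test_of_loc hp φ₀).const_mul m)]
    refine integral_congr_ae (Eventually.of_forall fun x => ?_)
    have : deriv χ x = ψ x - m * φ₀ x := congrArg (fun θ : 𝓓(Ω, ℂ) => θ x) hχ
    simp only [this]
    ring
  rw [h2, hχ, map_sub, map_smul, smul_eq_mul] at h1
  rw [setIntegral_mul_test, setIntegral_mul_test]
  have h3 : ∀ c : ℂ, ∫ x, prim c h x * ψ x = c * m + ∫ x, prim 0 h x * ψ x := by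
    intro c
    rw [← integral_const_mul, ← integral_add ((hint ψ).const_mul c)
      (integrable_mul_test_of_loc hp ψ)]
    refine integral_congr_ae (Eventually.of_forall fun x => ?_)
    simp only [prim]
    ring
  rw [h3]
  linear_combination h1

theorem ae_eq_of_integral_mul_test_eq {Ω : Opens ℝ} {f g : ℝ → ℂ} (hf : LocallyIntegrable f)
    (hg : LocallyIntegrable g)
    (h : ∀ φ : 𝓓(Ω, ℂ), ∫ x in (Ω : Set ℝ), f x * φ x = ∫ x in (Ω : Set ℝ), g x * φ x) :
    f =ᵐ[volume.restrict (Ω : Set ℝ)] g := by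
  have key : ∀ᵐ x, x ∈ (Ω : Set ℝ) → f x - g x = 0 := by
    have hfg : LocallyIntegrable fun x => f x - g x := hf.sub hg
    refine Ω.isOpen.ae_eq_zero_of_integral_contDiff_smul_eq_zero
      (hfg.locallyIntegrableOn _) ?_
    intro ψ hψ hc hs
    have hs' : tsupport (fun x => (ψ x : ℂ)) ⊆ Ω :=
      (closure_mono fun x hx => by simpa [Function.mem_support] using hx).trans hs
    let φ : 𝓓(Ω, ℂ) := ⟨fun x => (ψ x : ℂ), Complex.ofRealCLM.contDiff.comp hψ,
      hc.comp_left (g := Complex.ofReal) rfl, hs'⟩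
    have e := h φ
    rw [setIntegral_mul_test, setIntegral_mul_test, ← sub_eq_zero, ← integral_sub
      (integrable_mul_test_of_loc hf φ) (integrable_mul_test_of_loc hg φ)] at e
    rw [← e]
    refine integral_congr_ae (Eventually.of_forall fun x => ?_)
    change ψ x • (f x - g x) = f x * (ψ x : ℂ) - g x * (ψ x : ℂ)
    rw [Complex.real_smul]
    ring
  filter_upwards [(ae_restrict_iff' Ω.isOpen.measurableSet).2 key] with x hx
  exact sub_eq_zero.1 hx

/-! ### Continuous representatives of Sobolev functions -/

/-- The extension by zero of `f ∈ L²(Ω)`. -/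
def zeroExt {Ω : Opens ℝ} (f : L2 Ω) : ℝ → ℂ := (Ω : Set ℝ).indicator f

theorem zeroExt_memLp {Ω : Opens ℝ} (f : L2 Ω) : MemLp (zeroExt f) 2 volume :=
  (memLp_indicator_iff_restrict Ω.isOpen.measurableSet).2 (Lp.memLp f)

theorem zeroExt_loc {Ω : Opens ℝ} (f : L2 Ω) : LocallyIntegrable (zeroExt f) :=
  (zeroExt_memLp f).locallyIntegrable (by norm_num)

theorem zeroExt_ae {Ω : Opens ℝ} (f : L2 Ω) : zeroExt f =ᵐ[volume.restrict (Ω : Set ℝ)] f :=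
  indicator_ae_eq_restrict Ω.isOpen.measurableSet

theorem setIntegral_congr_mul {Ω : Opens ℝ} {f g : ℝ → ℂ}
    (h : f =ᵐ[volume.restrict (Ω : Set ℝ)] g) (ψ : ℝ → ℂ) :
    ∫ x in (Ω : Set ℝ), f x * ψ x = ∫ x in (Ω : Set ℝ), g x * ψ x := by
  refine integral_congr_ae ?_
  filter_upwards [h] with x hx
  rw [hx]

/-- The functional on test functions given by a locally integrable function. -/
def testPairing (Ω : Opens ℝ) {f : ℝ → ℂ} (hf : LocallyIntegrable f) : 𝓓(Ω, ℂ) →ₗ[ℂ] ℂ where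
  toFun φ := ∫ x in (Ω : Set ℝ), f x * φ x
  map_add' φ ψ := by
    rw [← integral_add (integrable_mul_test_of_loc hf φ).integrableOn
      (integrable_mul_test_of_loc hf ψ).integrableOn]
    refine integral_congr_ae (Eventually.of_forall fun x => ?_)
    change f x * (φ x + ψ x) = _
    ring
  map_smul' c φ := by
    rw [RingHom.id_apply, smul_eq_mul, ← integral_const_mul]
    refine integral_congr_ae (Eventually.of_forall fun x => ?_)
    change f x * (c * φ x) = _
    ring

theorem testPairing_apply {Ω : Opens ℝ} {f : ℝ → ℂ} (hf : LocallyIntegrable f) (φ : 𝓓(Ω, ℂ)) :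
    testPairing Ω hf φ = ∫ x in (Ω : Set ℝ), f x * φ x := rfl

theorem hasWeakDeriv_of_ae_eq_prim {Ω : Opens ℝ} {f g : L2 Ω} {c : ℂ} {h : ℝ → ℂ}
    (hh : LocallyIntegrable h) (hf : f =ᵐ[volume.restrict (Ω : Set ℝ)] prim c h)
    (hg : g =ᵐ[volume.restrict (Ω : Set ℝ)] h) : HasWeakDeriv Ω f g := by
  intro φ
  rw [setIntegral_congr_mul hf, setIntegral_congr_mul hg, integral_prim_mul_deriv hh]

theorem HasWeakDeriv.exists_prim {Ω : Opens ℝ} (hΩ : (Ω : Set ℝ).OrdConnected)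
    (hne : (Ω : Set ℝ).Nonempty) {f g : L2 Ω} (h : HasWeakDeriv Ω f g) :
    ∃ c, f =ᵐ[volume.restrict (Ω : Set ℝ)] prim c (zeroExt g) := by
  obtain ⟨c, hc⟩ := exists_prim_of_deriv hΩ hne (zeroExt_loc g) (testPairing Ω (zeroExt_loc f))
    fun φ => by
      rw [testPairing_apply, setIntegral_congr_mul (zeroExt_ae f),
        setIntegral_congr_mul (zeroExt_ae g)]
      exact h φ
  exact ⟨c, (zeroExt_ae f).symm.trans (ae_eq_of_integral_mul_test_eq (zeroExt_loc f)
    (prim_continuous (zeroExt_loc g) c).locallyIntegrable hc)⟩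

theorem hasBoundaryValue_of_ae_eq {Ω : Opens ℝ} {f : L2 Ω} {F : ℝ → ℂ} (hF : Continuous F)
    (hf : f =ᵐ[volume.restrict (Ω : Set ℝ)] F) : HasBoundaryValue Ω f (F 0) :=
  ⟨F, hF.continuousOn, hf, (hF.tendsto 0).mono_left nhdsWithin_le_nhds⟩

/-- Representatives continuous on the open set `Ω` that agree almost everywhere agree on all of `Ω`,
so their limits at `0` coincide. -/
theorem HasBoundaryValue.eq_of_ae_eq {Ω : Opens ℝ} (h0 : (0 : ℝ) ∈ closure (Ω : Set ℝ)) {f : L2 Ω}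
    {c : ℂ} (hc : HasBoundaryValue Ω f c) {F : ℝ → ℂ} (hF : Continuous F)
    (hf : f =ᵐ[volume.restrict (Ω : Set ℝ)] F) : c = F 0 := by
  obtain ⟨g, hg, hfg, hlim⟩ := hc
  have e := Measure.eqOn_open_of_ae_eq (hfg.symm.trans hf) Ω.isOpen hg hF.continuousOn
  have : (𝓝[(Ω : Set ℝ)] (0 : ℝ)).NeBot := mem_closure_iff_nhdsWithin_neBot.1 h0
  refine tendsto_nhds_unique hlim (((hF.tendsto 0).mono_left nhdsWithin_le_nhds).congr' ?_)
  filter_upwards [self_mem_nhdsWithin] with x hx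
  exact (e hx).symm

/-- `Ω` is one of the two half-lines, and `σ = ±1` is its direction. -/
def IsHalfLine (Ω : Opens ℝ) (σ : ℂ) : Prop := (Ω = posHalf ∧ σ = 1) ∨ (Ω = negHalf ∧ σ = -1)

theorem isHalfLine_pos : IsHalfLine posHalf 1 := Or.inl ⟨rfl, rfl⟩

theorem isHalfLine_neg : IsHalfLine negHalf (-1) := Or.inr ⟨rfl, rfl⟩

theorem IsHalfLine.ordConnected {Ω : Opens ℝ} {σ : ℂ} (h : IsHalfLine Ω σ) :
    (Ω : Set ℝ).OrdConnected := by
  rcases h with ⟨rfl, -⟩ | ⟨rfl, -⟩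
  · exact Set.ordConnected_Ioi
  · exact Set.ordConnected_Iio

theorem IsHalfLine.zero_mem_closure {Ω : Opens ℝ} {σ : ℂ} (h : IsHalfLine Ω σ) :
    (0 : ℝ) ∈ closure (Ω : Set ℝ) := by
  rcases h with ⟨rfl, -⟩ | ⟨rfl, -⟩
  · change (0 : ℝ) ∈ closure (Set.Ioi 0)
    simp
  · change (0 : ℝ) ∈ closure (Set.Iio 0)
    simp

theorem IsHalfLine.nonempty {Ω : Opens ℝ} {σ : ℂ} (h : IsHalfLine Ω σ) :
    (Ω : Set ℝ).Nonempty := closure_nonempty_iff.1 ⟨0, h.zero_mem_closure⟩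

theorem IsHalfLine.zero_notMem {Ω : Opens ℝ} {σ : ℂ} (h : IsHalfLine Ω σ) :
    (0 : ℝ) ∉ (Ω : Set ℝ) := by
  rcases h with ⟨rfl, -⟩ | ⟨rfl, -⟩
  · exact lt_irrefl (0 : ℝ)
  · exact lt_irrefl (0 : ℝ)

theorem HasWeakDeriv.exists_boundaryValue {Ω : Opens ℝ} {σ : ℂ} (hΩ : IsHalfLine Ω σ)
    {f g : L2 Ω} (hfg : HasWeakDeriv Ω f g) : ∃ c, HasBoundaryValue Ω f c := by
  obtain ⟨c, hc⟩ := hfg.exists_prim hΩ.ordConnected hΩ.nonempty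
  exact ⟨_, hasBoundaryValue_of_ae_eq (prim_continuous (zeroExt_loc g) c) hc⟩

/-- Identifies the unknown constant of integration with the boundary value, since a primitive takes
its constant as value at `0`. -/
theorem HasBoundaryValue.ae_eq_prim {Ω : Opens ℝ} {σ : ℂ} (hΩ : IsHalfLine Ω σ) {f g : L2 Ω}
    (hfg : HasWeakDeriv Ω f g) {c : ℂ} (hc : HasBoundaryValue Ω f c) :
    f =ᵐ[volume.restrict (Ω : Set ℝ)] prim c (zeroExt g) := by
  obtain ⟨d, hd⟩ := hfg.exists_prim hΩ.ordConnected hΩ.nonempty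
  have := hc.eq_of_ae_eq hΩ.zero_mem_closure (prim_continuous (zeroExt_loc g) d) hd
  rw [prim_zero] at this
  rwa [this]

/-! ### Integration by parts on a half-line -/

/-- By the product rule, the product of the primitives is itself a primitive of an integrable
function, so it has a limit at infinity. As the product is integrable on a set of infinite measure,
this limit is zero, and only the term at the vertex survives. -/
theorem integral_deriv_prim_mul {Ω : Opens ℝ} {σ : ℂ} (hΩ : IsHalfLine Ω σ) {f g : ℝ → ℂ}
    (hf : LocallyIntegrable f) (hg : LocallyIntegrable g) {c d : ℂ}
    (hk : IntegrableOn (fun t => f t * prim d g t + g t * prim c f t) Ω)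
    (hp : IntegrableOn (fun t => prim c f t * prim d g t) Ω) :
    ∫ t in (Ω : Set ℝ), (f t * prim d g t + g t * prim c f t) = -σ * (c * d) := by
  set k : ℝ → ℂ := fun t => f t * prim d g t + g t * prim c f t
  have e : ∀ x, prim c f x * prim d g x = c * d + ∫ t in (0 : ℝ)..x, k t := prim_mul hf hg c d
  simp only [e] at hp
  rcases hΩ with ⟨rfl, rfl⟩ | ⟨rfl, rfl⟩
  · have h1 : Tendsto (fun x => c * d + ∫ t in (0 : ℝ)..x, k t) atTop
        (𝓝 (c * d + ∫ t in Set.Ioi 0, k t)) :=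
      (intervalIntegral_tendsto_integral_Ioi 0 hk tendsto_id).const_add _
    have h2 := IntegrableAtFilter.eq_zero_of_tendsto (μ := volume)
      ⟨Set.Ioi 0, Ioi_mem_atTop 0, hp⟩ (fun s hs => by
        obtain ⟨b, hb⟩ := mem_atTop_sets.1 hs
        rw [← top_le_iff, ← Real.volume_Ici (a := b)]
        exact measure_mono hb) h1
    change ∫ t in Set.Ioi 0, k t = _
    linear_combination h2
  · have hk' : IntegrableOn k (Set.Iic 0) := by
      rw [integrableOn_Iic_iff_integrableOn_Iio]
      exact hk
    have h1 : Tendsto (fun x => c * d + ∫ t in (0 : ℝ)..x, k t) atBot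
        (𝓝 (c * d + -∫ t in Set.Iic 0, k t)) := by
      refine Tendsto.const_add _ ?_
      have := (intervalIntegral_tendsto_integral_Iic 0 hk' tendsto_id).neg
      exact this.congr fun x => (intervalIntegral.integral_symm _ _).symm
    have h2 := IntegrableAtFilter.eq_zero_of_tendsto (μ := volume)
      ⟨Set.Iio 0, Iio_mem_atBot 0, hp⟩ (fun s hs => by
        obtain ⟨b, hb⟩ := mem_atBot_sets.1 hs
        rw [← top_le_iff, ← Real.volume_Iic (a := b)]
        exact measure_mono hb) h1
    change ∫ t in Set.Iio 0, k t = _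
    rw [← integral_Iic_eq_integral_Iio]
    linear_combination -h2

theorem prim_conj (c : ℂ) (h : ℝ → ℂ) (x : ℝ) :
    prim (starRingEnd ℂ c) (fun t => starRingEnd ℂ (h t)) x = starRingEnd ℂ (prim c h x) := by
  rw [prim, prim, map_add, intervalIntegral.intervalIntegral_conj]

/-- Integration by parts in `H¹` of a half-line. -/
theorem HasWeakDeriv.inner_add_inner {Ω : Opens ℝ} {σ : ℂ} (hΩ : IsHalfLine Ω σ)
    {f f' g g' : L2 Ω} {c d : ℂ} (hf : HasWeakDeriv Ω f f') (hg : HasWeakDeriv Ω g g')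
    (hc : HasBoundaryValue Ω f c) (hd : HasBoundaryValue Ω g d) :
    inner ℂ g f' + inner ℂ g' f = -σ * (c * starRingEnd ℂ d) := by
  have hF := hc.ae_eq_prim hΩ hf
  have hG := hd.ae_eq_prim hΩ hg
  have hloc : LocallyIntegrable fun t => starRingEnd ℂ (zeroExt g' t) :=
    (zeroExt_memLp g').star.locallyIntegrable (by norm_num)
  have i1 : Integrable (fun x => f' x * starRingEnd ℂ (g x)) (volume.restrict (Ω : Set ℝ)) :=
    (Lp.memLp f').integrable_mul (q := 2) (Lp.memLp g).star
  have i2 : Integrable (fun x => f x * starRingEnd ℂ (g' x)) (volume.restrict (Ω : Set ℝ)) :=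
    (Lp.memLp f).integrable_mul (q := 2) (Lp.memLp g').star
  have i3 : Integrable (fun x => f x * starRingEnd ℂ (g x)) (volume.restrict (Ω : Set ℝ)) :=
    (Lp.memLp f).integrable_mul (q := 2) (Lp.memLp g).star
  have e : (fun x => f' x * starRingEnd ℂ (g x) + f x * starRingEnd ℂ (g' x))
      =ᵐ[volume.restrict (Ω : Set ℝ)] fun t => zeroExt f' t *
        prim (starRingEnd ℂ d) (fun t => starRingEnd ℂ (zeroExt g' t)) t +
        starRingEnd ℂ (zeroExt g' t) * prim c (zeroExt f') t := by
    filter_upwards [hF, hG, zeroExt_ae f', zeroExt_ae g'] with x h1 h2 h3 h4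
    rw [prim_conj, ← h1, ← h2, h3, h4]
    ring
  rw [← integral_deriv_prim_mul hΩ (zeroExt_loc f') hloc ((i1.add i2).congr e), ← integral_congr_ae e,
    integral_add i1 i2, L2.inner_def, L2.inner_def]
  · rfl
  · refine i3.congr ?_
    filter_upwards [hF, hG] with x h1 h2
    rw [prim_conj, ← h1, ← h2]

theorem mem_sobolev_three {Ω : Opens ℝ} {f f₁ f₂ f₃ : L2 Ω} (h₁ : HasWeakDeriv Ω f f₁)
    (h₂ : HasWeakDeriv Ω f₁ f₂) (h₃ : HasWeakDeriv Ω f₂ f₃) : f ∈ sobolev Ω 3 :=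
  ⟨f₁, ⟨f₂, ⟨f₃, Submodule.mem_top, h₃⟩, h₂⟩, h₁⟩

theorem iterWeakDeriv_one {Ω : Opens ℝ} {f f₁ : L2 Ω} (h₁ : HasWeakDeriv Ω f f₁) :
    iterWeakDeriv Ω 1 f = f₁ := h₁.weakDeriv_eq

theorem iterWeakDeriv_two {Ω : Opens ℝ} {f f₁ f₂ : L2 Ω} (h₁ : HasWeakDeriv Ω f f₁)
    (h₂ : HasWeakDeriv Ω f₁ f₂) : iterWeakDeriv Ω 2 f = f₂ := by
  rw [iterWeakDeriv, h₁.weakDeriv_eq, iterWeakDeriv_one h₂]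

theorem iterWeakDeriv_three {Ω : Opens ℝ} {f f₁ f₂ f₃ : L2 Ω} (h₁ : HasWeakDeriv Ω f f₁)
    (h₂ : HasWeakDeriv Ω f₁ f₂) (h₃ : HasWeakDeriv Ω f₂ f₃) : iterWeakDeriv Ω 3 f = f₃ := by
  rw [iterWeakDeriv, h₁.weakDeriv_eq, iterWeakDeriv_two h₂ h₃]

theorem exists_weakDerivs {Ω : Opens ℝ} {f : L2 Ω} (hf : f ∈ sobolev Ω 3) :
    ∃ f₁ f₂ f₃, HasWeakDeriv Ω f f₁ ∧ HasWeakDeriv Ω f₁ f₂ ∧ HasWeakDeriv Ω f₂ f₃ := by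
  obtain ⟨f₁, ⟨f₂, ⟨f₃, -, h₃⟩, h₂⟩, h₁⟩ := hf
  exact ⟨f₁, f₂, f₃, h₁, h₂, h₃⟩

theorem exists_boundaryData {Ω : Opens ℝ} {σ : ℂ} (hΩ : IsHalfLine Ω σ) {f : L2 Ω}
    (hf : f ∈ sobolev Ω 3) : ∃ a, HasBoundaryData Ω f a := by
  obtain ⟨f₁, f₂, f₃, h₁, h₂, h₃⟩ := exists_weakDerivs hf
  obtain ⟨a₀, ha₀⟩ := h₁.exists_boundaryValue hΩ
  obtain ⟨a₁, ha₁⟩ := h₂.exists_boundaryValue hΩ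
  obtain ⟨a₂, ha₂⟩ := h₃.exists_boundaryValue hΩ
  refine ⟨![a₀, a₁, a₂], fun j => ?_⟩
  fin_cases j
  · exact ha₀
  · change HasBoundaryValue Ω (iterWeakDeriv Ω 1 f) a₁
    rwa [iterWeakDeriv_one h₁]
  · change HasBoundaryValue Ω (iterWeakDeriv Ω 2 f) a₂
    rwa [iterWeakDeriv_two h₁ h₂]

/-- The boundary form of the Airy operator `u ↦ α u''' + β u'` on a half-line. -/
def boundaryForm (α β : ℝ) (a c : Fin 3 → ℂ) : ℂ :=
  α * (a 2 * starRingEnd ℂ (c 0) - a 1 * starRingEnd ℂ (c 1) + a 0 * starRingEnd ℂ (c 2))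
    + β * (a 0 * starRingEnd ℂ (c 0))

/-- Green's formula for the Airy operator on a half-line. -/
theorem inner_airy_add_inner_airy {Ω : Opens ℝ} {σ : ℂ} (hΩ : IsHalfLine Ω σ) (α β : ℝ)
    {u v : L2 Ω} (hu : u ∈ sobolev Ω 3) (hv : v ∈ sobolev Ω 3) {a c : Fin 3 → ℂ}
    (ha : HasBoundaryData Ω u a) (hc : HasBoundaryData Ω v c) :
    inner ℂ v ((α : ℂ) • iterWeakDeriv Ω 3 u + (β : ℂ) • iterWeakDeriv Ω 1 u)
      + inner ℂ ((α : ℂ) • iterWeakDeriv Ω 3 v + (β : ℂ) • iterWeakDeriv Ω 1 v) u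
      = -σ * boundaryForm α β a c := by
  obtain ⟨u₁, u₂, u₃, hu₁, hu₂, hu₃⟩ := exists_weakDerivs hu
  obtain ⟨v₁, v₂, v₃, hv₁, hv₂, hv₃⟩ := exists_weakDerivs hv
  have a0 : HasBoundaryValue Ω u (a 0) := ha 0
  have a1 : HasBoundaryValue Ω (iterWeakDeriv Ω 1 u) (a 1) := ha 1
  have a2 : HasBoundaryValue Ω (iterWeakDeriv Ω 2 u) (a 2) := ha 2
  have c0 : HasBoundaryValue Ω v (c 0) := hc 0
  have c1 : HasBoundaryValue Ω (iterWeakDeriv Ω 1 v) (c 1) := hc 1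
  have c2 : HasBoundaryValue Ω (iterWeakDeriv Ω 2 v) (c 2) := hc 2
  rw [iterWeakDeriv_one hu₁] at a1
  rw [iterWeakDeriv_one hv₁] at c1
  rw [iterWeakDeriv_two hu₁ hu₂] at a2
  rw [iterWeakDeriv_two hv₁ hv₂] at c2
  have e1 := hu₃.inner_add_inner hΩ hv₁ a2 c0
  have e2 := hu₂.inner_add_inner hΩ hv₂ a1 c1
  have e3 := hu₁.inner_add_inner hΩ hv₃ a0 c2
  have e4 := hu₁.inner_add_inner hΩ hv₁ a0 c0
  rw [iterWeakDeriv_three hu₁ hu₂ hu₃, iterWeakDeriv_three hv₁ hv₂ hv₃, iterWeakDeriv_one hu₁,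
    iterWeakDeriv_one hv₁]
  simp only [inner_add_left, inner_add_right, inner_smul_left, inner_smul_right,
    Complex.conj_ofReal, boundaryForm]
  -- The alternating sum telescopes: `⟪v₁, u₂⟫` and `⟪v₂, u₁⟫` cancel.
  linear_combination (α : ℂ) * (e1 - e2 + e3) + (β : ℂ) * e4

/-! ### Smooth functions in Sobolev spaces -/

/-- The restriction of a compactly supported smooth function to `Ω`, as an element of `L²(Ω)`. -/
def restrictTest (Ω : Opens ℝ) {Ω' : Opens ℝ} (φ : 𝓓(Ω', ℂ)) : L2 Ω :=
  MemLp.toLp φ (φ.continuous.memLp_of_hasCompactSupport φ.hasCompactSupport)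

theorem restrictTest_ae (Ω : Opens ℝ) {Ω' : Opens ℝ} (φ : 𝓓(Ω', ℂ)) :
    restrictTest Ω φ =ᵐ[volume.restrict (Ω : Set ℝ)] φ := MemLp.coeFn_toLp _

theorem hasWeakDeriv_restrictTest (Ω : Opens ℝ) {Ω' : Opens ℝ} (φ : 𝓓(Ω', ℂ)) :
    HasWeakDeriv Ω (restrictTest Ω φ) (restrictTest Ω (testDeriv Ω' φ)) := by
  refine hasWeakDeriv_of_ae_eq_prim (c := φ 0) (deriv_test_continuous φ).locallyIntegrable ?_
    (restrictTest_ae Ω (testDeriv Ω' φ))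
  rw [prim_deriv (φ.contDiff.of_le (by simp))]
  exact restrictTest_ae Ω φ

theorem restrictTest_mem_sobolev (Ω : Opens ℝ) {Ω' : Opens ℝ} (φ : 𝓓(Ω', ℂ)) :
    restrictTest Ω φ ∈ sobolev Ω 3 :=
  mem_sobolev_three (hasWeakDeriv_restrictTest Ω φ) (hasWeakDeriv_restrictTest Ω _)
    (hasWeakDeriv_restrictTest Ω _)

theorem hasBoundaryData_restrictTest (Ω : Opens ℝ) {Ω' : Opens ℝ} (φ : 𝓓(Ω', ℂ)) :
    HasBoundaryData Ω (restrictTest Ω φ) ![φ 0, deriv φ 0, deriv (deriv φ) 0] := by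
  have h : ∀ ψ : 𝓓(Ω', ℂ), HasBoundaryValue Ω (restrictTest Ω ψ) (ψ 0) := fun ψ =>
    hasBoundaryValue_of_ae_eq ψ.continuous (restrictTest_ae Ω ψ)
  have h1 := hasWeakDeriv_restrictTest Ω φ
  have h2 := hasWeakDeriv_restrictTest Ω (testDeriv Ω' φ)
  intro j
  fin_cases j
  · exact h φ
  · change HasBoundaryValue Ω (iterWeakDeriv Ω 1 _) (testDeriv Ω' φ 0)
    rw [iterWeakDeriv_one h1]
    exact h _
  · change HasBoundaryValue Ω (iterWeakDeriv Ω 2 _) (testDeriv Ω' (testDeriv Ω' φ) 0)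
    rw [iterWeakDeriv_two h1 h2]
    exact h _

/-- A quadratic polynomial with the given jet, cut off by a bump function that equals one near `0`.
-/
theorem exists_test_with_jet (a : Fin 3 → ℂ) :
    ∃ φ : 𝓓((⊤ : Opens ℝ), ℂ), ![φ 0, deriv φ 0, deriv (deriv φ) 0] = a := by
  let χ : ContDiffBump (0 : ℝ) := ⟨1, 2, one_pos, one_lt_two⟩
  let p : ℝ → ℂ := fun x => a 0 + a 1 * (x : ℂ) + a 2 / 2 * (x : ℂ) ^ 2
  have hx : ∀ x : ℝ, HasDerivAt (fun x : ℝ => (x : ℂ)) 1 x := fun x =>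
    (hasDerivAt_id x).ofReal_comp
  have hp : ContDiff ℝ ∞ p := by
    have : ContDiff ℝ ∞ fun x : ℝ => (x : ℂ) := Complex.ofRealCLM.contDiff
    exact (contDiff_const.add (contDiff_const.mul this)).add (contDiff_const.mul (this.pow 2))
  have hd1 : deriv p = fun x : ℝ => a 1 + a 2 * (x : ℂ) := by
    funext x
    have := (((hx x).const_mul (a 1)).const_add (a 0)).add (((hx x).pow 2).const_mul (a 2 / 2))
    have := this.deriv
    refine this.trans ?_
    push_cast
    ring
  have hd2 : deriv (deriv p) 0 = a 2 := by
    rw [hd1]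
    refine (((hx 0).const_mul (a 2)).const_add (a 1)).deriv.trans ?_
    ring
  have hcs : HasCompactSupport fun x => (χ x : ℂ) * p x :=
    (χ.hasCompactSupport.comp_left (g := Complex.ofReal) rfl).mul_right
  let φ : 𝓓((⊤ : Opens ℝ), ℂ) := ⟨fun x => (χ x : ℂ) * p x,
    (Complex.ofRealCLM.contDiff.comp χ.contDiff).mul hp, hcs, fun _ _ => trivial⟩
  have e : φ =ᶠ[𝓝 0] p := by
    filter_upwards [χ.eventuallyEq_one] with x h
    change (χ x : ℂ) * p x = p x
    rw [h]
    simp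
  refine ⟨φ, ?_⟩
  funext j
  fin_cases j
  · refine e.eq_of_nhds.trans ?_
    simp [p]
  · refine e.deriv.eq_of_nhds.trans ?_
    rw [hd1]
    simp
  · exact e.deriv.deriv.eq_of_nhds.trans hd2

theorem exists_mem_sobolev_boundaryData (Ω : Opens ℝ) (a : Fin 3 → ℂ) :
    ∃ f ∈ sobolev Ω 3, HasBoundaryData Ω f a := by
  obtain ⟨φ, hφ⟩ := exists_test_with_jet a
  exact ⟨_, restrictTest_mem_sobolev Ω φ, hφ ▸ hasBoundaryData_restrictTest Ω φ⟩

theorem testToL2_eq_restrictTest {Ω : Opens ℝ} (φ : 𝓓(Ω, ℂ)) :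
    testToL2 Ω φ = restrictTest Ω φ := rfl

theorem testToL2_ae {Ω : Opens ℝ} (φ : 𝓓(Ω, ℂ)) :
    testToL2 Ω φ =ᵐ[volume.restrict (Ω : Set ℝ)] φ := restrictTest_ae Ω φ

theorem hasBoundaryData_testToL2 {Ω : Opens ℝ} (h0 : (0 : ℝ) ∉ (Ω : Set ℝ)) (φ : 𝓓(Ω, ℂ)) :
    HasBoundaryData Ω (testToL2 Ω φ) 0 := by
  have h : ![φ 0, deriv φ 0, deriv (deriv φ) 0] = 0 := by
    have e0 : φ 0 = 0 := test_eq_zero φ h0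
    have e1 : deriv φ 0 = 0 := test_eq_zero (testDeriv Ω φ) h0
    have e2 : deriv (deriv φ) 0 = 0 := test_eq_zero (testDeriv Ω (testDeriv Ω φ)) h0
    rw [e0, e1, e2]
    funext j
    fin_cases j <;> rfl
  have := hasBoundaryData_restrictTest Ω φ
  rwa [h] at this

theorem testToL2_testAiry {Ω : Opens ℝ} (α β : ℝ) (φ : 𝓓(Ω, ℂ)) :
    testToL2 Ω (testAiry Ω α β φ) = (α : ℂ) • iterWeakDeriv Ω 3 (testToL2 Ω φ)
      + (β : ℂ) • iterWeakDeriv Ω 1 (testToL2 Ω φ) := by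
  rw [testToL2_eq_restrictTest φ, iterWeakDeriv_three (hasWeakDeriv_restrictTest Ω φ)
    (hasWeakDeriv_restrictTest Ω _) (hasWeakDeriv_restrictTest Ω _),
    iterWeakDeriv_one (hasWeakDeriv_restrictTest Ω φ)]
  simp only [testAiry, LinearMap.add_apply, LinearMap.smul_apply, map_add, map_smul,
    LinearMap.comp_apply, testToL2_eq_restrictTest]

/-- The complex conjugate of a test function. -/
def conjTest {Ω : Opens ℝ} (φ : 𝓓(Ω, ℂ)) : 𝓓(Ω, ℂ) :=
  ⟨fun x => starRingEnd ℂ (φ x), Complex.conjCLE.contDiff.comp φ.contDiff,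
    φ.hasCompactSupport.comp_left (g := starRingEnd ℂ) (map_zero _),
    (closure_mono fun x hx => by
      simpa [Function.mem_support] using hx).trans φ.tsupport_subset⟩

theorem testDeriv_conjTest {Ω : Opens ℝ} (φ : 𝓓(Ω, ℂ)) :
    testDeriv Ω (conjTest φ) = conjTest (testDeriv Ω φ) := by
  ext x
  have h : HasDerivAt φ (deriv φ x) x := (φ.contDiff.differentiable (by simp) x).hasDerivAt
  exact (Complex.conjCLE.toContinuousLinearMap.hasFDerivAt.comp_hasDerivAt x h).deriv

theorem testAiry_conjTest {Ω : Opens ℝ} (α β : ℝ) (φ : 𝓓(Ω, ℂ)) :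
    testAiry Ω α β (conjTest φ) = conjTest (testAiry Ω α β φ) := by
  simp only [testAiry, LinearMap.add_apply, LinearMap.smul_apply, LinearMap.comp_apply,
    testDeriv_conjTest]
  ext x
  change (α : ℂ) * starRingEnd ℂ (testDeriv Ω (testDeriv Ω (testDeriv Ω φ)) x)
    + (β : ℂ) * starRingEnd ℂ (testDeriv Ω φ x) = starRingEnd ℂ
    ((α : ℂ) * (testDeriv Ω (testDeriv Ω (testDeriv Ω φ)) x) + (β : ℂ) * testDeriv Ω φ x)
  simp only [map_add, map_mul, Complex.conj_ofReal]

/-- Translates between the sesquilinear inner product of the adjoint and the bilinear pairing that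
defines weak derivatives. -/
theorem inner_conjTest {Ω : Opens ℝ} (φ : 𝓓(Ω, ℂ)) (f : L2 Ω) :
    inner ℂ (testToL2 Ω (conjTest φ)) f = ∫ x in (Ω : Set ℝ), f x * φ x := by
  rw [L2.inner_def]
  refine integral_congr_ae ?_
  filter_upwards [testToL2_ae (conjTest φ)] with x hx
  rw [hx, RCLike.inner_apply]
  change f x * starRingEnd ℂ (starRingEnd ℂ (φ x)) = _
  rw [Complex.conj_conj]

theorem eq_zero_of_inner_testToL2_eq_zero {Ω : Opens ℝ} {f : L2 Ω}
    (h : ∀ φ, inner ℂ (testToL2 Ω φ) f = 0) : f = 0 := by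
  -- An `f` orthogonal to all test functions is a weak derivative of `0`, and so is `0`.
  refine HasWeakDeriv.unique (f := 0) (fun φ => ?_) (hasWeakDeriv_zero Ω)
  rw [← inner_conjTest φ f, h, hasWeakDeriv_zero Ω φ]
  have := inner_conjTest φ (0 : L2 Ω)
  rw [inner_zero_right] at this
  rw [← this]

theorem dense_range_testToL2Graph : Dense (LinearMap.range testToL2Graph : Set L2Graph) := by
  rw [Submodule.dense_iff_topologicalClosure_eq_top, Submodule.topologicalClosure_eq_top_iff,
    Submodule.eq_bot_iff]
  intro v hv
  have h : ∀ φ, inner ℂ (testToL2Graph φ) v = 0 := fun φ =>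
    Submodule.mem_orthogonal _ _ |>.1 hv _ ⟨φ, rfl⟩
  have h1 : v.fst = 0 := eq_zero_of_inner_testToL2_eq_zero fun φ => by
    have := h (φ, 0)
    rw [WithLp.prod_inner_apply] at this
    change inner ℂ (testToL2 negHalf φ) v.fst + inner ℂ (testToL2 posHalf 0) v.snd = 0 at this
    rwa [map_zero, inner_zero_left, add_zero] at this
  have h2 : v.snd = 0 := eq_zero_of_inner_testToL2_eq_zero fun φ => by
    have := h (0, φ)
    rw [WithLp.prod_inner_apply] at this
    change inner ℂ (testToL2 negHalf 0) v.fst + inner ℂ (testToL2 posHalf φ) v.snd = 0 at this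
    rwa [map_zero, inner_zero_left, zero_add] at this
  exact WithLp.ofLp_injective 2 (Prod.ext h1 h2)

theorem airyMin_le_airyExt (αm αp βm βp : ℝ) (L : Matrix (Fin 3) (Fin 3) ℂ) :
    airyMin αm αp βm βp ≤ airyExt αm αp βm βp L := by
  refine ⟨?_, ?_⟩
  · rintro _ ⟨φ, rfl⟩
    exact ⟨restrictTest_mem_sobolev _ φ.1, restrictTest_mem_sobolev _ φ.2, 0, 0,
      hasBoundaryData_testToL2 isHalfLine_neg.zero_notMem φ.1,
      hasBoundaryData_testToL2 isHalfLine_pos.zero_notMem φ.2, Matrix.mulVec_zero L⟩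
  · rintro ⟨_, φ, rfl⟩ ⟨y, hy⟩ hxy
    change testToL2Graph φ = y at hxy
    subst hxy
    have e : (LinearEquiv.ofInjective testToL2Graph testToL2Graph_injective).symm
        ⟨testToL2Graph φ, φ, rfl⟩ = φ :=
      (LinearEquiv.symm_apply_eq _).2 rfl
    change testToL2Graph (((testAiry negHalf αm βm).prodMap (testAiry posHalf αp βp))
      ((LinearEquiv.ofInjective testToL2Graph testToL2Graph_injective).symm
        ⟨testToL2Graph φ, φ, rfl⟩)) = _
    rw [e]
    refine WithLp.ofLp_injective 2 (Prod.ext ?_ ?_)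
    · exact testToL2_testAiry αm βm φ.1
    · exact testToL2_testAiry αp βp φ.2

theorem dense_domain_airyExt (αm αp βm βp : ℝ) (L : Matrix (Fin 3) (Fin 3) ℂ) :
    Dense ((airyExt αm αp βm βp L).domain : Set L2Graph) :=
  dense_range_testToL2Graph.mono (airyMin_le_airyExt αm αp βm βp L).1

/-! ### Regularity for the Airy equation on a half-line -/

/-- Cauchy–Schwarz on an interval of length two, from `(f - m / 2)² ≥ 0`, where `m / 2` is the mean
of `f`. -/
theorem sq_intervalIntegral_le {f : ℝ → ℝ} {a : ℝ} (h1 : IntervalIntegrable f volume a (a + 2))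
    (h2 : IntervalIntegrable (fun x => f x ^ 2) volume a (a + 2)) :
    (∫ x in a..(a + 2), f x) ^ 2 ≤ 2 * ∫ x in a..(a + 2), f x ^ 2 := by
  set m := ∫ x in a..(a + 2), f x
  have h : 0 ≤ ∫ x in a..(a + 2), (f x ^ 2 - m * f x + m ^ 2 / 4) := by
    refine intervalIntegral.integral_nonneg (by linarith) fun x _ => ?_
    nlinarith [sq_nonneg (f x - m / 2)]
  rw [intervalIntegral.integral_add (h2.sub (h1.const_mul m)) intervalIntegrable_const,
    intervalIntegral.integral_sub h2 (h1.const_mul m), intervalIntegral.integral_const_mul,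
    intervalIntegral.integral_const] at h
  simp only [smul_eq_mul] at h
  have : m = ∫ x in a..(a + 2), f x := rfl
  rw [← this] at h
  nlinarith

/-- Moving averages of `L²` functions are `L²` functions. -/
theorem memLp_integral_norm {k : ℝ → ℂ} (hk : MemLp k 2 volume) :
    MemLp (fun x => ∫ t in x..(x + 2), ‖k t‖) 2 volume := by
  have hloc : LocallyIntegrable k := hk.locallyIntegrable (by norm_num)
  have hii : ∀ a b, IntervalIntegrable (fun t => ‖k t‖) volume a b := fun a b =>
    (intervalIntegrable_of_loc hloc a b).norm
  have hsq : Integrable fun t => ‖k t‖ ^ 2 := (memLp_two_iff_integrable_sq_norm hk.1).1 hk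
  have hcont : Continuous fun x => ∫ t in x..(x + 2), ‖k t‖ := by
    have hp := intervalIntegral.continuous_primitive hii 0
    have : (fun x => ∫ t in x..(x + 2), ‖k t‖) =
        fun x => (∫ t in (0 : ℝ)..(x + 2), ‖k t‖) - ∫ t in (0 : ℝ)..x, ‖k t‖ := by
      funext x
      rw [intervalIntegral.integral_interval_sub_left (hii _ _) (hii _ _)]
    rw [this]
    exact (hp.comp (continuous_id.add continuous_const)).sub hp
  rw [memLp_two_iff_integrable_sq hcont.aestronglyMeasurable]
  -- The moving integral of `‖k‖²` over `[x, x + 2]` is the convolution with this indicator, hence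
  -- integrable.
  have hind : Integrable ((Set.Ioc (-2 : ℝ) 0).indicator fun _ => (1 : ℝ)) :=
    (integrable_indicator_iff measurableSet_Ioc).2 (integrableOn_const (by simp))
  have hconv := hind.integrable_convolution (ContinuousLinearMap.mul ℝ ℝ) hsq
  refine (hconv.const_mul 2).mono' (hcont.pow 2).aestronglyMeasurable
    (Eventually.of_forall fun x => ?_)
  have e : convolution ((Set.Ioc (-2 : ℝ) 0).indicator fun _ => (1 : ℝ)) (fun t => ‖k t‖ ^ 2)
      (ContinuousLinearMap.mul ℝ ℝ) volume x = ∫ t in x..(x + 2), ‖k t‖ ^ 2 := by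
    have h1 := intervalIntegral.integral_comp_sub_left (a := -2) (b := 0)
      (fun t => ‖k t‖ ^ 2) x
    rw [sub_zero, sub_neg_eq_add] at h1
    rw [← h1, intervalIntegral.integral_of_le (by norm_num), ← integral_indicator measurableSet_Ioc]
    refine integral_congr_ae (Eventually.of_forall fun t => ?_)
    by_cases ht : t ∈ Set.Ioc (-2 : ℝ) 0 <;> simp [ht]
  rw [e, Real.norm_of_nonneg (sq_nonneg _)]
  exact sq_intervalIntegral_le (hii _ _) hsq.intervalIntegrable

theorem norm_integral_le_of_subset {k : ℝ → ℂ} (hk : LocallyIntegrable k) {x s : ℝ}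
    (h1 : x ≤ s) (h2 : s ≤ x + 2) : ‖∫ t in x..s, k t‖ ≤ ∫ t in x..(x + 2), ‖k t‖ := by
  refine (intervalIntegral.norm_integral_le_integral_norm h1).trans ?_
  exact intervalIntegral.integral_mono_interval le_rfl h1 h2
    (Eventually.of_forall fun t => norm_nonneg _) (intervalIntegrable_of_loc hk _ _).norm

/-- Second-order Taylor formula for `M` with `M' = N`, `N' = P - β f`, `P' = g`. The deviation of `N
t` from `N x + (t - x) P x` is `∫ (P - P x) - β ∫ f`, bounded by integrals of `‖g‖` and `‖f‖` over
`[x, x + 2]`; integrating over a step `h ≤ 2` gives the outer factor 2. -/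
theorem prim_taylor {f g : ℝ → ℂ} (hf : LocallyIntegrable f) (hg : LocallyIntegrable g)
    (β c₁ c₂ c₃ : ℂ) {x h : ℝ} (h0 : 0 ≤ h) (h2 : h ≤ 2) :
    ‖prim c₃ (prim c₂ fun t => prim c₁ g t - β * f t) (x + h)
      - prim c₃ (prim c₂ fun t => prim c₁ g t - β * f t) x
      - (h * prim c₂ (fun t => prim c₁ g t - β * f t) x + h ^ 2 / 2 * prim c₁ g x)‖
      ≤ 2 * (2 * (∫ t in x..(x + 2), ‖g t‖) + ‖β‖ * ∫ t in x..(x + 2), ‖f t‖) := by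
  set P := prim c₁ g with hP
  set N := prim c₂ fun t => P t - β * f t with hN
  set K := 2 * (∫ t in x..(x + 2), ‖g t‖) + ‖β‖ * ∫ t in x..(x + 2), ‖f t‖
  have hPc : Continuous P := prim_continuous hg c₁
  have hfβ : LocallyIntegrable fun t => β * f t := hf.smul β
  have hq : LocallyIntegrable fun t => P t - β * f t := hPc.locallyIntegrable.sub hfβ
  have hNc : Continuous N := prim_continuous hq c₂
  have hbound : ∀ t ∈ Set.uIoc x (x + h), ‖N t - (N x + (t - x : ℝ) * P x)‖ ≤ K := by
    intro t ht
    rw [Set.uIoc_of_le (by linarith)] at ht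
    have hxt : x ≤ t := ht.1.le
    have ht2 : t ≤ x + 2 := by linarith [ht.2]
    have e : N t - (N x + (t - x : ℝ) * P x) =
        (∫ s in x..t, (P s - P x)) - β * ∫ s in x..t, f s := by
      have h1 : N t - N x = ∫ s in x..t, (P s - β * f s) := prim_sub hq c₂ x t
      rw [intervalIntegral.integral_sub (hPc.intervalIntegrable _ _)
        (intervalIntegrable_of_loc hfβ _ _), intervalIntegral.integral_const_mul] at h1
      rw [intervalIntegral.integral_sub (hPc.intervalIntegrable _ _) intervalIntegrable_const,
        intervalIntegral.integral_const, Complex.real_smul]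
      linear_combination h1
    rw [e]
    have b1 : ‖∫ s in x..t, (P s - P x)‖ ≤ (∫ t in x..(x + 2), ‖g t‖) * |t - x| := by
      refine intervalIntegral.norm_integral_le_of_norm_le_const fun s hs => ?_
      rw [Set.uIoc_of_le hxt] at hs
      rw [hP, prim_sub hg]
      exact norm_integral_le_of_subset hg hs.1.le (hs.2.trans ht2)
    have b2 : ‖β * ∫ s in x..t, f s‖ ≤ ‖β‖ * ∫ t in x..(x + 2), ‖f t‖ := by
      rw [norm_mul]
      exact mul_le_mul_of_nonneg_left (norm_integral_le_of_subset hf hxt ht2) (norm_nonneg _)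
    have hJ : 0 ≤ ∫ t in x..(x + 2), ‖g t‖ :=
      intervalIntegral.integral_nonneg (by linarith) fun t _ => norm_nonneg _
    have : (∫ t in x..(x + 2), ‖g t‖) * |t - x| ≤ 2 * ∫ t in x..(x + 2), ‖g t‖ := by
      rw [abs_of_nonneg (by linarith), mul_comm]
      exact mul_le_mul_of_nonneg_right (by linarith) hJ
    exact (norm_sub_le _ _).trans (by linarith)
  have hK : 0 ≤ K := by
    have h1 : 0 ≤ ∫ t in x..(x + 2), ‖g t‖ :=
      intervalIntegral.integral_nonneg (by linarith) fun t _ => norm_nonneg _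
    have h2 : 0 ≤ ∫ t in x..(x + 2), ‖f t‖ :=
      intervalIntegral.integral_nonneg (by linarith) fun t _ => norm_nonneg _
    positivity
  have hle := intervalIntegral.norm_integral_le_of_norm_le_const hbound
  have e1 : ∫ t in x..(x + h), (N x + ((t - x : ℝ) : ℂ) * P x) = h * N x + h ^ 2 / 2 * P x := by
    have hd : ∀ t ∈ Set.uIcc x (x + h), HasDerivAt
        (fun t : ℝ => ((t - x : ℝ) : ℂ) * N x + ((t - x : ℝ) : ℂ) ^ 2 / 2 * P x)
        (N x + ((t - x : ℝ) : ℂ) * P x) t := by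
      intro t _
      have h1 : HasDerivAt (fun t : ℝ => ((t - x : ℝ) : ℂ)) 1 t := by
        have := ((hasDerivAt_id t).sub_const x).ofReal_comp
        simpa using this
      have := (h1.mul_const (N x)).add (((h1.pow 2).div_const 2).mul_const (P x))
      refine this.congr_deriv ?_
      push_cast
      ring
    rw [intervalIntegral.integral_eq_sub_of_hasDerivAt hd
      (Continuous.intervalIntegrable (by fun_prop) _ _)]
    simp
  have e2 : ∫ t in x..(x + h), (N t - (N x + ((t - x : ℝ) : ℂ) * P x)) =
      prim c₃ N (x + h) - prim c₃ N x - (h * N x + h ^ 2 / 2 * P x) := by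
    rw [intervalIntegral.integral_sub (hNc.intervalIntegrable _ _)
      (Continuous.intervalIntegrable (by fun_prop) _ _), e1, prim_sub hNc.locallyIntegrable]
  rw [e2] at hle
  refine hle.trans ?_
  rw [add_sub_cancel_left, abs_of_nonneg h0, mul_comm]
  exact mul_le_mul_of_nonneg_right h2 hK

/-- A priori regularity on `(0, ∞)`: if `P' = g`, `N' = P - β f`, `M' = N` and `M = α f` with `f`
and `g` in `L²`, then `P` and `N` are in `L²`. -/
theorem memLp_prim_Ioi {f g : ℝ → ℂ} (hf : MemLp f 2 volume) (hg : MemLp g 2 volume)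
    {α β c₁ c₂ c₃ : ℂ} (hM : (fun x => α * f x) =ᵐ[volume.restrict (Set.Ioi 0)]
      prim c₃ (prim c₂ fun t => prim c₁ g t - β * f t)) :
    MemLp (prim c₁ g) 2 (volume.restrict (Set.Ioi 0)) ∧
      MemLp (prim c₂ fun t => prim c₁ g t - β * f t) 2 (volume.restrict (Set.Ioi 0)) := by
  have hfl : LocallyIntegrable f := hf.locallyIntegrable (by norm_num)
  have hgl : LocallyIntegrable g := hg.locallyIntegrable (by norm_num)
  set P := prim c₁ g with hP
  set N := prim c₂ fun t => P t - β * f t with hN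
  set M := prim c₃ N
  have hPc : Continuous P := prim_continuous hgl c₁
  have hfβ : LocallyIntegrable fun t => β * f t := hfl.smul β
  have hNc : Continuous N := prim_continuous (hPc.locallyIntegrable.sub hfβ) c₂
  have hMc : Continuous M := prim_continuous hNc.locallyIntegrable c₃
  -- Forward translations keep `x + h` in the half-line, where `M` agrees with `α f`.
  have hshift : ∀ h : ℝ, 0 ≤ h → MemLp (fun x => M (x + h)) 2 (volume.restrict (Set.Ioi 0)) := by
    intro h h0
    have m1 : MemLp (fun x => α * f (x + h)) 2 volume :=
      (hf.comp_measurePreserving (measurePreserving_add_right volume h)).const_mul α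
    refine (m1.restrict (Set.Ioi 0)).ae_eq ?_
    rw [EventuallyEq, ae_restrict_iff' measurableSet_Ioi] at hM ⊢
    have := (measurePreserving_add_right volume h).quasiMeasurePreserving.ae hM
    filter_upwards [this] with x hx hx0
    exact hx (by simp only [Set.mem_Ioi] at hx0 ⊢; linarith)
  set K : ℝ → ℝ := fun x => 2 * (∫ t in x..(x + 2), ‖g t‖) + ‖β‖ * ∫ t in x..(x + 2), ‖f t‖
  have hK : MemLp K 2 (volume.restrict (Set.Ioi 0)) :=
    (((memLp_integral_norm hg).const_mul 2).add
      ((memLp_integral_norm hf).const_mul ‖β‖)).restrict _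
  have h0 := (hshift 0 le_rfl).norm
  have h1 := (hshift 1 zero_le_one).norm
  have h2 := (hshift 2 zero_le_two).norm
  have t1 : ∀ x, ‖M (x + 1) - M x - (N x + 1 / 2 * P x)‖ ≤ 2 * K x := fun x => by
    have := prim_taylor hfl hgl β c₁ c₂ c₃ (x := x) zero_le_one one_le_two
    simpa using this
  have t2 : ∀ x, ‖M (x + 2) - M x - (2 * N x + 2 * P x)‖ ≤ 2 * K x := fun x => by
    have := prim_taylor hfl hgl β c₁ c₂ c₃ (x := x) zero_le_two le_rfl
    norm_num at this
    exact this
  -- In the second difference of `M` the terms in `N x` cancel and `P x` remains; the errors add up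
  -- to `2K + 2 · 2K`.
  have bP : ∀ x, ‖P x‖ ≤ ‖M (x + 2)‖ + 2 * ‖M (x + 1)‖ + ‖M (x + 0)‖ + 6 * K x := fun x => by
    have e : P x = M (x + 2) - 2 * M (x + 1) + M (x + 0)
        - (M (x + 2) - M x - (2 * N x + 2 * P x))
        + 2 * (M (x + 1) - M x - (N x + 1 / 2 * P x)) := by
      rw [add_zero]
      ring
    have n1 := norm_add_le (M (x + 2) - 2 * M (x + 1) + M (x + 0)
        - (M (x + 2) - M x - (2 * N x + 2 * P x)))
        (2 * (M (x + 1) - M x - (N x + 1 / 2 * P x)))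
    have n2 := norm_sub_le (M (x + 2) - 2 * M (x + 1) + M (x + 0))
      (M (x + 2) - M x - (2 * N x + 2 * P x))
    have n3 := norm_add_le (M (x + 2) - 2 * M (x + 1)) (M (x + 0))
    have n4 := norm_sub_le (M (x + 2)) (2 * M (x + 1))
    rw [← e] at n1
    rw [norm_mul, Complex.norm_ofNat] at n1 n4
    linarith [t1 x, t2 x]
  have bN : ∀ x, ‖N x‖ ≤ ‖M (x + 1)‖ + ‖M (x + 0)‖ + ‖P x‖ + 2 * K x := fun x => by
    have e : N x = M (x + 1) - M (x + 0) - 1 / 2 * P x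
        - (M (x + 1) - M x - (N x + 1 / 2 * P x)) := by
      rw [add_zero]
      ring
    have n1 := norm_sub_le (M (x + 1) - M (x + 0) - 1 / 2 * P x)
      (M (x + 1) - M x - (N x + 1 / 2 * P x))
    have n2 := norm_sub_le (M (x + 1) - M (x + 0)) (1 / 2 * P x)
    have n3 := norm_sub_le (M (x + 1)) (M (x + 0))
    rw [← e] at n1
    have nh : ‖(1 / 2 : ℂ)‖ = 1 / 2 := by norm_num
    rw [norm_mul, nh] at n2
    linarith [t1 x, norm_nonneg (P x)]
  have mP : MemLp P 2 (volume.restrict (Set.Ioi 0)) :=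
    (((h2.add (h1.const_mul 2)).add h0).add (hK.const_mul 6)).mono' hPc.aestronglyMeasurable
      (Eventually.of_forall bP)
  exact ⟨mP, (((h1.add h0).add mP.norm).add (hK.const_mul 2)).mono' hNc.aestronglyMeasurable
    (Eventually.of_forall bN)⟩

theorem prim_comp_neg (c : ℂ) (h : ℝ → ℂ) (x : ℝ) :
    prim c h (-x) = prim c (fun t => -h (-t)) x := by
  rw [prim, prim, intervalIntegral.integral_neg, intervalIntegral.integral_comp_neg, neg_zero,
    ← intervalIntegral.integral_symm]

theorem prim_neg (c : ℂ) (h : ℝ → ℂ) (x : ℝ) :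
    prim (-c) (fun t => -h t) x = -prim c h x := by
  rw [prim, prim, intervalIntegral.integral_neg, neg_add]

theorem measurePreserving_neg_Ioi :
    MeasurePreserving (fun x : ℝ => -x) (volume.restrict (Set.Iio 0))
      (volume.restrict (Set.Ioi 0)) := by
  have := (Measure.measurePreserving_neg (volume : Measure ℝ)).restrict_preimage
    (measurableSet_Ioi (a := (0 : ℝ)))
  have e : (Neg.neg : ℝ → ℝ) ⁻¹' Set.Ioi 0 = Set.Iio 0 := by
    ext x
    simp
  rwa [e] at this

theorem measurePreserving_neg_Iio :
    MeasurePreserving (fun x : ℝ => -x) (volume.restrict (Set.Ioi 0))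
      (volume.restrict (Set.Iio 0)) := by
  have := (Measure.measurePreserving_neg (volume : Measure ℝ)).restrict_preimage
    (measurableSet_Iio (a := (0 : ℝ)))
  have e : (Neg.neg : ℝ → ℝ) ⁻¹' Set.Iio 0 = Set.Ioi 0 := by
    ext x
    simp
  rwa [e] at this

/-- Reflection `x ↦ -x` of the case of `(0, ∞)`. It preserves `f`, `P` and `M` and flips the sign of
`g` and `N`, hence of `c₂`. -/
theorem memLp_prim_Iio {f g : ℝ → ℂ} (hf : MemLp f 2 volume) (hg : MemLp g 2 volume)
    {α β c₁ c₂ c₃ : ℂ} (hM : (fun x => α * f x) =ᵐ[volume.restrict (Set.Iio 0)]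
      prim c₃ (prim c₂ fun t => prim c₁ g t - β * f t)) :
    MemLp (prim c₁ g) 2 (volume.restrict (Set.Iio 0)) ∧
      MemLp (prim c₂ fun t => prim c₁ g t - β * f t) 2 (volume.restrict (Set.Iio 0)) := by
  have hneg := Measure.measurePreserving_neg (volume : Measure ℝ)
  have hf' : MemLp (fun x => f (-x)) 2 volume := hf.comp_measurePreserving hneg
  have hg' : MemLp (fun x => -g (-x)) 2 volume := (hg.comp_measurePreserving hneg).neg
  have eP : ∀ x, prim c₁ (fun t => -g (-t)) x = prim c₁ g (-x) := fun x =>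
    (prim_comp_neg c₁ g x).symm
  have eN : ∀ x, prim (-c₂) (fun t => prim c₁ (fun t => -g (-t)) t - β * f (-t)) x =
      -prim c₂ (fun t => prim c₁ g t - β * f t) (-x) := fun x => by
    rw [prim_comp_neg, ← prim_neg]
    simp only [eP, neg_neg]
  have hM' : (fun x => α * f (-x)) =ᵐ[volume.restrict (Set.Ioi 0)]
      prim c₃ (prim (-c₂) fun t => prim c₁ (fun t => -g (-t)) t - β * f (-t)) := by
    filter_upwards [measurePreserving_neg_Iio.quasiMeasurePreserving.ae hM] with x hx
    rw [hx, prim_comp_neg]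
    congr 1
    funext t
    rw [eN]
  obtain ⟨h1, h2⟩ := memLp_prim_Ioi hf' hg' hM'
  have h1' := h1.comp_measurePreserving measurePreserving_neg_Ioi
  have h2' := (h2.comp_measurePreserving measurePreserving_neg_Ioi).neg
  refine ⟨h1'.ae_eq (Eventually.of_forall fun x => ?_),
    h2'.ae_eq (Eventually.of_forall fun x => ?_)⟩
  · simp only [Function.comp_apply, eP, neg_neg]
  · simp only [Pi.neg_apply, Function.comp_apply, eN, neg_neg]

/-- A distributional solution `v ∈ L²` of `α v''' + β v' = -w` with `w ∈ L²` on a half-line belongs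
to `H³`. -/
theorem airy_regularity {Ω : Opens ℝ} {σ : ℂ} (hΩ : IsHalfLine Ω σ) {α β : ℝ} (hα : α ≠ 0)
    {v w : L2 Ω} (h : ∀ φ : 𝓓(Ω, ℂ), ∫ x in (Ω : Set ℝ), v x * testAiry Ω α β φ x
      = ∫ x in (Ω : Set ℝ), w x * φ x) :
    v ∈ sobolev Ω 3 ∧ (α : ℂ) • iterWeakDeriv Ω 3 v + (β : ℂ) • iterWeakDeriv Ω 1 v = -w := by
  have hα' : (α : ℂ) ≠ 0 := by exact_mod_cast hα
  set f := zeroExt v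
  set g := zeroExt (-w)
  have hf : LocallyIntegrable f := zeroExt_loc v
  have hg : LocallyIntegrable g := zeroExt_loc (-w)
  have hfβ : LocallyIntegrable fun t => (β : ℂ) * f t := hf.smul (β : ℂ)
  let T := testPairing Ω hf
  -- First integration: the distribution `α v'' + β v` has derivative `-w`, so it is a primitive
  -- `P`.
  obtain ⟨c₁, h₁⟩ := exists_prim_of_deriv hΩ.ordConnected hΩ.nonempty hg
    ((α : ℂ) • (T ∘ₗ testDeriv Ω ∘ₗ testDeriv Ω) + (β : ℂ) • T) fun φ => by
      have e1 : ((α : ℂ) • (T ∘ₗ testDeriv Ω ∘ₗ testDeriv Ω) + (β : ℂ) • T) (testDeriv Ω φ) =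
          T (testAiry Ω α β φ) := by
        simp only [testAiry, LinearMap.add_apply, LinearMap.smul_apply, LinearMap.comp_apply,
          map_add, map_smul]
      rw [e1, testPairing_apply, setIntegral_congr_mul (zeroExt_ae v), h φ,
        setIntegral_congr_mul (zeroExt_ae (-w)), ← integral_neg]
      refine integral_congr_ae ?_
      filter_upwards [Lp.coeFn_neg w] with x hx
      rw [hx, Pi.neg_apply]
      ring
  have hPc : Continuous (prim c₁ g) := prim_continuous hg c₁
  have hq : LocallyIntegrable fun t => prim c₁ g t - β * f t := hPc.locallyIntegrable.sub hfβ
  -- Second integration: the distribution `α v'` has derivative `P - β v`. The minus sign comes from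
  -- moving one derivative to the test function.
  obtain ⟨c₂, h₂⟩ := exists_prim_of_deriv hΩ.ordConnected hΩ.nonempty hq
    (-((α : ℂ) • (T ∘ₗ testDeriv Ω))) fun φ => by
      have e1 := h₁ φ
      have e2 : ∫ x in (Ω : Set ℝ), (prim c₁ g x - β * f x) * φ x =
          (∫ x in (Ω : Set ℝ), prim c₁ g x * φ x) - β * T φ := by
        rw [testPairing_apply, ← integral_const_mul, ← integral_sub
          (integrable_mul_test_of_loc hPc.locallyIntegrable φ).integrableOn
          ((integrable_mul_test_of_loc hf φ).integrableOn.const_mul _)]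
        refine integral_congr_ae (Eventually.of_forall fun x => ?_)
        ring
      rw [e2, ← e1]
      simp only [LinearMap.add_apply, LinearMap.smul_apply, LinearMap.comp_apply,
        LinearMap.neg_apply, smul_eq_mul]
      ring
  have hNc : Continuous (prim c₂ fun t => prim c₁ g t - β * f t) := prim_continuous hq c₂
  obtain ⟨c₃, h₃⟩ := exists_prim_of_deriv hΩ.ordConnected hΩ.nonempty hNc.locallyIntegrable
    ((α : ℂ) • T) fun φ => by
      rw [← h₂ φ]
      simp only [LinearMap.smul_apply, LinearMap.comp_apply, LinearMap.neg_apply, neg_neg]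
  set P := prim c₁ g with hP
  set N := prim c₂ fun t => P t - β * f t with hN
  have hM : (fun x => (α : ℂ) * f x) =ᵐ[volume.restrict (Ω : Set ℝ)] prim c₃ N := by
    refine ae_eq_of_integral_mul_test_eq (hf.smul (α : ℂ))
      (prim_continuous hNc.locallyIntegrable c₃).locallyIntegrable fun φ => ?_
    rw [← h₃ φ, LinearMap.smul_apply, smul_eq_mul, testPairing_apply, ← integral_const_mul]
    refine integral_congr_ae (Eventually.of_forall fun x => ?_)
    ring
  -- So far `P` and `N` are merely continuous; their square integrability comes from `M = α v ∈ L²`.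
  obtain ⟨mP, mN⟩ : MemLp P 2 (volume.restrict (Ω : Set ℝ)) ∧
      MemLp N 2 (volume.restrict (Ω : Set ℝ)) := by
    rcases hΩ with ⟨rfl, -⟩ | ⟨rfl, -⟩
    · exact memLp_prim_Ioi (zeroExt_memLp v) (zeroExt_memLp (-w)) hM
    · exact memLp_prim_Iio (zeroExt_memLp v) (zeroExt_memLp (-w)) hM
  let p : L2 Ω := mP.toLp P
  let n : L2 Ω := mN.toLp N
  have dp : HasWeakDeriv Ω p (-w) :=
    hasWeakDeriv_of_ae_eq_prim hg mP.coeFn_toLp (zeroExt_ae (-w)).symm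
  have dn : HasWeakDeriv Ω n (p + (-(β : ℂ)) • v) := by
    refine hasWeakDeriv_of_ae_eq_prim hq mN.coeFn_toLp ?_
    filter_upwards [Lp.coeFn_add p ((-(β : ℂ)) • v), Lp.coeFn_smul (-(β : ℂ)) v,
      mP.coeFn_toLp, zeroExt_ae v] with x h1 h2 h3 h4
    rw [h1, Pi.add_apply, h2, Pi.smul_apply, h3, ← h4, smul_eq_mul]
    ring
  have dv : HasWeakDeriv Ω v ((α : ℂ)⁻¹ • n) := by
    have : HasWeakDeriv Ω ((α : ℂ) • v) n := by
      refine hasWeakDeriv_of_ae_eq_prim (c := c₃) hNc.locallyIntegrable ?_ mN.coeFn_toLp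
      filter_upwards [Lp.coeFn_smul (α : ℂ) v, zeroExt_ae v, hM] with x h1 h2 h3
      rw [h1, ← h3, Pi.smul_apply, ← h2, smul_eq_mul]
    have := this.smul (α : ℂ)⁻¹
    rwa [inv_smul_smul₀ hα'] at this
  have d1 := dn.smul (α : ℂ)⁻¹
  have d2 := (dp.add (dv.smul (-(β : ℂ)))).smul (α : ℂ)⁻¹
  refine ⟨mem_sobolev_three dv d1 d2, ?_⟩
  rw [iterWeakDeriv_three dv d1 d2, iterWeakDeriv_one dv, smul_inv_smul₀ hα']
  module

/-! ### Skew-self-adjoint extensions of the Airy operator -/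

/-- Only `u` has to satisfy the boundary relation. Leaving the data `c`, `d` of `v` unrelated allows
`v` to be taken from the adjoint domain. The opposite directions of the half-lines produce the
difference of forms. -/
theorem airyExt_green (αm αp βm βp : ℝ) (L : Matrix (Fin 3) (Fin 3) ℂ)
    (u : (airyExt αm αp βm βp L).domain) {v : L2Graph} (hv₁ : v.fst ∈ sobolev negHalf 3)
    (hv₂ : v.snd ∈ sobolev posHalf 3) {a c d : Fin 3 → ℂ} (ha : HasBoundaryData negHalf u.1.fst a)
    (hb : HasBoundaryData posHalf u.1.snd (L.mulVec a)) (hc : HasBoundaryData negHalf v.fst c)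
    (hd : HasBoundaryData posHalf v.snd d) :
    inner ℂ v (airyExt αm αp βm βp L u) + inner ℂ (WithLp.toLp 2
        ((αm : ℂ) • iterWeakDeriv negHalf 3 v.fst + (βm : ℂ) • iterWeakDeriv negHalf 1 v.fst,
         (αp : ℂ) • iterWeakDeriv posHalf 3 v.snd + (βp : ℂ) • iterWeakDeriv posHalf 1 v.snd)) u.1
      = boundaryForm αm βm a c - boundaryForm αp βp (L.mulVec a) d := by
  have e1 := inner_airy_add_inner_airy isHalfLine_neg αm βm u.2.1 hv₁ ha hc
  have e2 := inner_airy_add_inner_airy isHalfLine_pos αp βp u.2.2.1 hv₂ hb hd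
  rw [WithLp.prod_inner_apply, WithLp.prod_inner_apply]
  have e3 : ∀ x y z w : ℂ, x + y + (z + w) = (x + z) + (y + w) := fun x y z w => by ring
  rw [e3]
  refine (congrArg₂ (· + ·) e1 e2).trans ?_
  ring

/-- Unit vectors read off the entries. The entry at `0` has to come first, as the `β` term mixes it
into the equation for the entry at `2`. -/
theorem boundaryForm_left_injective {α : ℝ} (hα : α ≠ 0) (β : ℝ) {c d : Fin 3 → ℂ}
    (h : ∀ b, boundaryForm α β b c = boundaryForm α β b d) : c = d := by
  have hα' : (α : ℂ) ≠ 0 := by exact_mod_cast hα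
  have h0 := h ![0, 0, 1]
  have h1 := h ![0, 1, 0]
  have h2 := h ![1, 0, 0]
  simp [boundaryForm, hα'] at h0 h1 h2
  rw [h0] at h2
  simp [hα'] at h2
  funext j
  fin_cases j
  · exact (starRingEnd ℂ).injective h0
  · exact (starRingEnd ℂ).injective h1
  · exact (starRingEnd ℂ).injective h2

theorem exists_mem_domain_airyExt (αm αp βm βp : ℝ) (L : Matrix (Fin 3) (Fin 3) ℂ)
    (a : Fin 3 → ℂ) : ∃ u : (airyExt αm αp βm βp L).domain,
      HasBoundaryData negHalf u.1.fst a ∧ HasBoundaryData posHalf u.1.snd (L.mulVec a) := by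
  obtain ⟨f, hf, hfa⟩ := exists_mem_sobolev_boundaryData negHalf a
  obtain ⟨g, hg, hgb⟩ := exists_mem_sobolev_boundaryData posHalf (L.mulVec a)
  exact ⟨⟨WithLp.toLp 2 (f, g), hf, hg, a, _, hfa, hgb, rfl⟩, hfa, hgb⟩

theorem airyExt_apply (αm αp βm βp : ℝ) (L : Matrix (Fin 3) (Fin 3) ℂ)
    (u : (airyExt αm αp βm βp L).domain) : airyExt αm αp βm βp L u = WithLp.toLp 2
      ((αm : ℂ) • iterWeakDeriv negHalf 3 u.1.fst + (βm : ℂ) • iterWeakDeriv negHalf 1 u.1.fst,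
       (αp : ℂ) • iterWeakDeriv posHalf 3 u.1.snd + (βp : ℂ) • iterWeakDeriv posHalf 1 u.1.snd) :=
  rfl

/-- The weak form of the Airy equation for an element `v` with
`⟪testToL2 φ, w⟫ = ⟪testToL2 (α φ''' + β φ'), v⟫`. -/
theorem airy_regularity_of_inner {Ω : Opens ℝ} {σ : ℂ} (hΩ : IsHalfLine Ω σ) {α β : ℝ}
    (hα : α ≠ 0) {v w : L2 Ω} (h : ∀ φ : 𝓓(Ω, ℂ),
      inner ℂ (testToL2 Ω (testAiry Ω α β φ)) v = inner ℂ (testToL2 Ω φ) w) :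
    v ∈ sobolev Ω 3 ∧ (α : ℂ) • iterWeakDeriv Ω 3 v + (β : ℂ) • iterWeakDeriv Ω 1 v = -w :=
  airy_regularity hΩ hα fun φ => by
    rw [← inner_conjTest, ← inner_conjTest, ← testAiry_conjTest, h]

/-- Pairing with the elements of `D(A₀)` alone turns membership in the adjoint domain into the
distributional Airy equation on each half-line, so `airy_regularity` applies whatever `L` is. -/
theorem adjoint_airyExt_mem {αm αp βm βp : ℝ} (hαm : αm ≠ 0) (hαp : αp ≠ 0)
    {L : Matrix (Fin 3) (Fin 3) ℂ} (v : (airyExt αm αp βm βp L)†.domain) :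
    v.1.fst ∈ sobolev negHalf 3 ∧ v.1.snd ∈ sobolev posHalf 3 ∧
      WithLp.toLp 2
        ((αm : ℂ) • iterWeakDeriv negHalf 3 v.1.fst + (βm : ℂ) • iterWeakDeriv negHalf 1 v.1.fst,
         (αp : ℂ) • iterWeakDeriv posHalf 3 v.1.snd + (βp : ℂ) • iterWeakDeriv posHalf 1 v.1.snd)
      = -(airyExt αm αp βm βp L)† v := by
  set w := (airyExt αm αp βm βp L)† v with hw
  have hle := airyMin_le_airyExt αm αp βm βp L
  have key : ∀ φ : 𝓓(negHalf, ℂ) × 𝓓(posHalf, ℂ), inner ℂ (testToL2Graph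
      (testAiry negHalf αm βm φ.1, testAiry posHalf αp βp φ.2)) v.1
      = inner ℂ (testToL2Graph φ) w := by
    intro φ
    have hφ := hle.1 (⟨φ, rfl⟩ : testToL2Graph φ ∈ LinearMap.range testToL2Graph)
    have h := (LinearPMap.adjoint_isFormalAdjoint (dense_domain_airyExt αm αp βm βp L)).symm
      ⟨_, hφ⟩ v
    rw [← hw, airyExt_apply] at h
    rw [← h]
    congr 1
    refine WithLp.ofLp_injective 2 (Prod.ext ?_ ?_)
    · exact testToL2_testAiry αm βm φ.1
    · exact testToL2_testAiry αp βp φ.2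
  obtain ⟨m1, e1⟩ := airy_regularity_of_inner isHalfLine_neg hαm (v := v.1.fst) (w := w.fst)
    fun φ => by
      have h := key (φ, 0)
      rw [WithLp.prod_inner_apply, WithLp.prod_inner_apply] at h
      change inner ℂ (testToL2 negHalf (testAiry negHalf αm βm φ)) v.1.fst
        + inner ℂ (testToL2 posHalf (testAiry posHalf αp βp 0)) v.1.snd =
        inner ℂ (testToL2 negHalf φ) w.fst + inner ℂ (testToL2 posHalf 0) w.snd at h
      simpa only [map_zero, inner_zero_left, add_zero] using h
  obtain ⟨m2, e2⟩ := airy_regularity_of_inner isHalfLine_pos hαp (v := v.1.snd) (w := w.snd)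
    fun φ => by
      have h := key (0, φ)
      rw [WithLp.prod_inner_apply, WithLp.prod_inner_apply] at h
      change inner ℂ (testToL2 negHalf (testAiry negHalf αm βm 0)) v.1.fst
        + inner ℂ (testToL2 posHalf (testAiry posHalf αp βp φ)) v.1.snd =
        inner ℂ (testToL2 negHalf 0) w.fst + inner ℂ (testToL2 posHalf φ) w.snd at h
      simpa only [map_zero, inner_zero_left, zero_add] using h
  exact ⟨m1, m2, WithLp.ofLp_injective 2 (Prod.ext e1 e2)⟩

/-- An extension of the Airy operator given by a surjective boundary matrix is skew-self-adjoint if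
and only if the matrix intertwines the boundary forms of the two half-lines. -/
theorem isSkewSelfAdjoint_airyExt_iff {αm αp βm βp : ℝ} (hαm : αm ≠ 0) (hαp : αp ≠ 0)
    {L : Matrix (Fin 3) (Fin 3) ℂ} (hL : Function.Surjective L.mulVec) :
    IsSkewSelfAdjoint (airyExt αm αp βm βp L) ↔
      ∀ a c, boundaryForm αm βm a c = boundaryForm αp βp (L.mulVec a) (L.mulVec c) := by
  have hdense := dense_domain_airyExt αm αp βm βp L
  constructor
  · rintro ⟨-, h⟩ a c
    obtain ⟨u, ha, hb⟩ := exists_mem_domain_airyExt αm αp βm βp L a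
    obtain ⟨v, hc, hd⟩ := exists_mem_domain_airyExt αm αp βm βp L c
    have hg := airyExt_green αm αp βm βp L u v.2.1 v.2.2.1 ha hb hc hd
    rw [← airyExt_apply] at hg
    have hform := LinearPMap.adjoint_isFormalAdjoint hdense
    rw [h] at hform
    have := hform v u
    rw [LinearPMap.neg_apply, inner_neg_left] at this
    rw [← this, neg_add_cancel] at hg
    exact (sub_eq_zero.1 hg.symm)
  · intro hform
    have hle : (airyExt αm αp βm βp L)† ≤ -airyExt αm αp βm βp L := by
      refine ⟨?_, ?_⟩
      · intro v hv
        obtain ⟨h1, h2, h3⟩ := adjoint_airyExt_mem hαm hαp ⟨v, hv⟩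
        obtain ⟨c, hc⟩ := exists_boundaryData isHalfLine_neg h1
        obtain ⟨d, hd⟩ := exists_boundaryData isHalfLine_pos h2
        refine ⟨h1, h2, c, d, hc, hd, ?_⟩
        -- Green's formula and `hform` show that `L c` and `d` pair equally with every `L a`, and
        -- these exhaust all vectors by surjectivity.
        refine boundaryForm_left_injective hαp βp fun b => ?_
        obtain ⟨a, rfl⟩ := hL b
        obtain ⟨u, ha, hb⟩ := exists_mem_domain_airyExt αm αp βm βp L a
        have hg := airyExt_green αm αp βm βp L u h1 h2 ha hb hc hd
        have hadj := LinearPMap.adjoint_isFormalAdjoint hdense ⟨v, hv⟩ u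
        rw [h3, inner_neg_left, hadj, add_neg_cancel] at hg
        rw [← hform]
        exact sub_eq_zero.1 hg.symm
      · intro v y hvy
        obtain ⟨h1, h2, h3⟩ := adjoint_airyExt_mem hαm hαp v
        rw [LinearPMap.neg_apply, airyExt_apply, ← neg_eq_iff_eq_neg, ← h3]
        obtain ⟨y, hy⟩ := y
        change v.1 = y at hvy
        subst hvy
        rfl
    -- The reverse inclusion is skew-symmetry: for two elements of the domain the boundary terms
    -- cancel.
    refine ⟨hdense, le_antisymm hle (LinearPMap.IsFormalAdjoint.le_adjoint hdense fun u v => ?_)⟩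
    obtain ⟨h1, h2, a, b, ha, hb, rfl⟩ := u.2
    obtain ⟨h3, h4, c, d, hc, hd, rfl⟩ := v.2
    have hg := airyExt_green αm αp βm βp L u h3 h4 ha hb hc hd
    rw [hform, sub_self] at hg
    have hg' := congrArg (starRingEnd ℂ) hg
    rw [map_add, inner_conj_symm, inner_conj_symm, map_zero] at hg'
    rw [LinearPMap.neg_apply, inner_neg_right]
    exact eq_neg_of_add_eq_zero_left hg'

/-! ### The matrix `L_Z` -/

theorem LZ_mulVec (Z : ℝ) (a : Fin 3 → ℂ) : (LZ Z).mulVec a =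
    ![a 0, (Z : ℂ) * a 0 + a 1, (Z : ℂ) ^ 2 / 2 * a 0 + (Z : ℂ) * a 1 + a 2] := by
  funext j
  fin_cases j <;> simp [LZ, Matrix.mulVec, dotProduct, Fin.sum_univ_three]

theorem LZ_mulVec_surjective (Z : ℝ) : Function.Surjective (LZ Z).mulVec := by
  intro b
  refine ⟨![b 0, b 1 - Z * b 0, b 2 - (Z : ℂ) ^ 2 / 2 * b 0 - Z * (b 1 - Z * b 0)], ?_⟩
  rw [LZ_mulVec]
  funext j
  fin_cases j <;> simp

theorem LZ_mulVec_eq_iff (Z : ℝ) (a b : Fin 3 → ℂ) : (LZ Z).mulVec a = b ↔ a 0 = b 0 ∧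
    b 1 - a 1 = (Z : ℂ) * a 0 ∧ (Z : ℂ) ^ 2 / 2 * a 0 + (Z : ℂ) * a 1 = b 2 - a 2 := by
  rw [LZ_mulVec, funext_iff, Fin.forall_fin_succ, Fin.forall_fin_succ, Fin.forall_fin_one]
  refine and_congr Iff.rfl (and_congr ?_ ?_)
  · change (Z : ℂ) * a 0 + a 1 = b 1 ↔ _
    rw [sub_eq_iff_eq_add, eq_comm]
  · change (Z : ℂ) ^ 2 / 2 * a 0 + (Z : ℂ) * a 1 + a 2 = b 2 ↔ _
    rw [eq_sub_iff_add_eq]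

/-- Conceptually, `L_Z = exp (Z S)` for the nilpotent shift `S (a₀, a₁, a₂) = (0, a₀, a₁)`, which is
skew for the form: the `α` terms cancel in pairs and the `β` term does not see `S`. The proof
expands directly. -/
theorem boundaryForm_LZ (α β Z : ℝ) (a c : Fin 3 → ℂ) :
    boundaryForm α β ((LZ Z).mulVec a) ((LZ Z).mulVec c) = boundaryForm α β a c := by
  rw [LZ_mulVec, LZ_mulVec]
  simp only [boundaryForm, Matrix.cons_val_zero, Matrix.cons_val_one, Matrix.cons_val, map_add,
    map_mul, map_div₀, map_pow, Complex.conj_ofReal, Complex.conj_ofNat]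
  ring

theorem boundaryForm_inj {α α' β β' : ℝ} :
    (∀ a c, boundaryForm α β a c = boundaryForm α' β' a c) ↔ α = α' ∧ β = β' := by
  constructor
  · intro h
    have h1 := h ![0, 1, 0] ![0, 1, 0]
    have h2 := h ![1, 0, 0] ![1, 0, 0]
    simp [boundaryForm] at h1 h2
    exact ⟨h1, h2⟩
  · rintro ⟨rfl, rfl⟩ a c
    rfl

theorem isSkewSelfAdjoint_airyDelta_iff {αm αp : ℝ} (hαm : αm ≠ 0) (hαp : αp ≠ 0) (βm βp Z : ℝ) :
    IsSkewSelfAdjoint (airyDelta αm αp βm βp Z) ↔ αm = αp ∧ βm = βp := by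
  rw [airyDelta, isSkewSelfAdjoint_airyExt_iff hαm hαp (LZ_mulVec_surjective Z)]
  simp only [boundaryForm_LZ]
  exact boundaryForm_inj

/-! ### Gluing `H¹` functions at the vertex -/

theorem zeroExt_neg_of_nonneg (f : L2 negHalf) {x : ℝ} (hx : 0 ≤ x) : zeroExt f x = 0 :=
  Set.indicator_of_notMem (s := Set.Iio 0) (not_lt.2 hx) _

theorem zeroExt_pos_of_nonpos (f : L2 posHalf) {x : ℝ} (hx : x ≤ 0) : zeroExt f x = 0 :=
  Set.indicator_of_notMem (s := Set.Ioi 0) (not_lt.2 hx) _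

theorem prim_congr {c : ℂ} {h k : ℝ → ℂ} {x : ℝ} (e : ∀ t ∈ Set.uIcc 0 x, t ≠ 0 → h t = k t) :
    prim c h x = prim c k x := by
  rw [prim, prim]
  congr 1
  refine intervalIntegral.integral_congr_ae ?_
  filter_upwards [Measure.ae_ne volume (0 : ℝ)] with t ht htx
  exact e t (Set.uIoc_subset_uIcc htx) ht

/-- Two `H¹` functions on the half-lines with the same boundary value form an `H¹` function on the
line. -/
theorem exists_glue {f f' : L2 negHalf} {g g' : L2 posHalf} {c : ℂ} (hf : HasWeakDeriv negHalf f f')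
    (hg : HasWeakDeriv posHalf g g') (hfc : HasBoundaryValue negHalf f c)
    (hgc : HasBoundaryValue posHalf g c) :
    ∃ w ∈ sobolev ⊤ 1, w =ᵐ[volume.restrict (Set.Iio (0 : ℝ))] f ∧
      w =ᵐ[volume.restrict (Set.Ioi (0 : ℝ))] g := by
  have mw : MemLp (fun x => zeroExt f x + zeroExt g x) 2 volume :=
    (zeroExt_memLp f).add (zeroExt_memLp g)
  have mw' : MemLp (fun x => zeroExt f' x + zeroExt g' x) 2 volume :=
    (zeroExt_memLp f').add (zeroExt_memLp g')
  let w : L2 ⊤ := (mw.restrict _).toLp _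
  let w' : L2 ⊤ := (mw'.restrict _).toLp _
  have hw : w =ᵐ[volume] fun x => zeroExt f x + zeroExt g x := by
    filter_upwards [(ae_restrict_iff' MeasurableSet.univ).1
      (mw.restrict ((⊤ : Opens ℝ) : Set ℝ)).coeFn_toLp] with x hx
    exact hx trivial
  have hneg : (fun x => zeroExt f x + zeroExt g x) =ᵐ[volume.restrict (Set.Iio (0 : ℝ))] f := by
    filter_upwards [zeroExt_ae f, ae_restrict_mem measurableSet_Iio] with x h1 h2
    rw [h1, zeroExt_pos_of_nonpos g (le_of_lt h2), add_zero]
  have hpos : (fun x => zeroExt f x + zeroExt g x) =ᵐ[volume.restrict (Set.Ioi (0 : ℝ))] g := by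
    filter_upwards [zeroExt_ae g, ae_restrict_mem measurableSet_Ioi] with x h1 h2
    rw [h1, zeroExt_neg_of_nonneg f (le_of_lt h2), zero_add]
  refine ⟨w, ⟨w', Submodule.mem_top, ?_⟩, EventuallyEq.trans (ae_restrict_of_ae hw) hneg,
    EventuallyEq.trans (ae_restrict_of_ae hw) hpos⟩
  -- The common boundary value serves as the one constant for both sides. Each zero-extended
  -- derivative vanishes on the opposite half-line, so the glued function is a single primitive of
  -- their sum.
  refine hasWeakDeriv_of_ae_eq_prim (c := c) (mw'.locallyIntegrable (by norm_num)) ?_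
    (mw'.restrict _).coeFn_toLp
  refine ae_restrict_of_ae (hw.trans ?_)
  have p1 := hfc.ae_eq_prim isHalfLine_neg hf
  have p2 := hgc.ae_eq_prim isHalfLine_pos hg
  have q1 := (ae_restrict_iff' measurableSet_Iio).1 (hneg.trans p1)
  have q2 := (ae_restrict_iff' measurableSet_Ioi).1 (hpos.trans p2)
  filter_upwards [q1, q2, Measure.ae_ne volume (0 : ℝ)] with x h1 h2 h0
  rcases lt_or_gt_of_ne h0 with hx | hx
  · rw [h1 hx]
    refine prim_congr fun t ht _ => ?_
    rw [Set.uIcc_of_ge hx.le] at ht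
    rw [zeroExt_pos_of_nonpos g' ht.2, add_zero]
  · rw [h2 hx]
    refine prim_congr fun t ht _ => ?_
    rw [Set.uIcc_of_le hx.le] at ht
    rw [zeroExt_neg_of_nonneg f' ht.1, zero_add]

end AiryGraph

end
theorem proposition2p3 (Z : ℝ) (hZ : Z ≠ 0) (αm αp βm βp : ℝ) (hαm : 0 < αm) (hαp : 0 < αp) :
    -- the boundary relation of `L_Z` amounts to the vertex conditions of δ-type
    (∀ u : AiryGraph.L2Graph, u ∈ (AiryGraph.airyDelta αm αp βm βp Z).domain ↔
      u.fst ∈ AiryGraph.sobolev AiryGraph.negHalf 3 ∧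
      u.snd ∈ AiryGraph.sobolev AiryGraph.posHalf 3 ∧
      ∃ a b : Fin 3 → ℂ,
        AiryGraph.HasBoundaryData AiryGraph.negHalf u.fst a ∧
        AiryGraph.HasBoundaryData AiryGraph.posHalf u.snd b ∧
        a 0 = b 0 ∧
        b 1 - a 1 = (Z : ℂ) * a 0 ∧
        (Z : ℂ) ^ 2 / 2 * a 0 + (Z : ℂ) * a 1 = b 2 - a 2) ∧
    -- `A_Z` extends `A₀`
    AiryGraph.airyMin αm αp βm βp ≤ AiryGraph.airyDelta αm αp βm βp Z ∧
    -- `A_Z` is skew-self-adjoint exactly for equal coefficients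
    (AiryGraph.IsSkewSelfAdjoint (AiryGraph.airyDelta αm αp βm βp Z) ↔ αm = αp ∧ βm = βp) ∧
    -- the elements of `D(A_Z)` are `H¹` functions on the line
    (∀ u ∈ (AiryGraph.airyDelta αm αp βm βp Z).domain,
      ∃ w ∈ AiryGraph.sobolev ⊤ 1,
        w =ᵐ[volume.restrict (Set.Iio (0 : ℝ))] u.fst ∧
        w =ᵐ[volume.restrict (Set.Ioi (0 : ℝ))] u.snd) := by
  refine ⟨fun u => ?_, AiryGraph.airyMin_le_airyExt αm αp βm βp _,
    AiryGraph.isSkewSelfAdjoint_airyDelta_iff hαm.ne' hαp.ne' βm βp Z, ?_⟩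
  · simp only [← AiryGraph.LZ_mulVec_eq_iff]
    rfl
  · rintro u ⟨h1, h2, a, b, ha, hb, hab⟩
    obtain ⟨f₁, -, -, hf, -⟩ := AiryGraph.exists_weakDerivs h1
    obtain ⟨g₁, -, -, hg, -⟩ := AiryGraph.exists_weakDerivs h2
    have e : a 0 = b 0 := ((AiryGraph.LZ_mulVec_eq_iff Z a b).1 hab).1
    exact AiryGraph.exists_glue hf hg (ha 0) (e ▸ hb 0)
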